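/- **Setting.** Let $n,m\ge 1$, $p,l\ge 0$ be integers, let $\Theta\subseteq\mathbb{R}^p$ be non-empty, and let $|\cdot|$ denote the Euclidean norm, $v^+=\max(v,0)$, $\mathbb{R}_+=[0,+\infty)$. Consider the control system $$\dot x_i=x_{i+1},\quad i=1,\dots,n,$$ $$\dot y_j=h_j(x,y_1,\dots,y_j)+g_j(x,y_1,\dots,y_j,\theta)\,y_{j+1}+\varphi_j'(x,y_1,\dots,y_j)\,\theta+\alpha_j'(x,y_1,\dots,y_j)\,d,\quad j=1,\dots,m,$$ with $x_{n+1}=y_1$, $y_{m+1}=u$, state $(x,y)\in\mathbb{R}^n\times\mathbb{R}^m$, control input $u\in\mathbb{R}$ and disturbances $d\in\mathbb{R}^l$, $\theta\in\Theta$. The mappings $h_j:\mathbb{R}^n\times\mathbb{R}^j\to\mathbb{R}$, $g_j:\mathbb{R}^n\times\mathbb{R}^j\times\Theta\to\mathbb{R}$, $\varphi_j:\mathbb{R}^n\times\mathbb{R}^j\to\mathbb{R}^p$, $\alpha_j:\mathbb{R}^n\times\mathbb{R}^j\to\mathbb{R}^l$ are smooth, with $h_j(0,0)=0$ and $\varphi_j(0,0)=0$.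 Moreover, for every $R>0$, each $g_j$ is bounded, and Lipschitz in $(x,y_1,\dots,y_j)$ uniformly in $\theta$, on the set of those $(x,y_1,\dots,y_j,\theta)\in\mathbb{R}^n\times\mathbb{R}^j\times\Theta$ of norm at most $R$ (this is automatic if $\Theta$ is closed). Assume that there are smooth positive functions $\eta_j:\mathbb{R}^n\times\mathbb{R}^j\to(0,+\infty)$ for $j=1,\dots,m$ and $\mu_j:\mathbb{R}^n\times\mathbb{R}^j\to(0,+\infty)$ for $j=1,\dots,m-1$ such that, for all $(x,y_1,\dots,y_j)\in\mathbb{R}^n\times\mathbb{R}^j$ and $\theta\in\Theta$, $$\eta_j(x,y_1,\dots,y_j)\le g_j(x,y_1,\dots,y_j,\theta)\ \ (j=1,\dots,m),\qquad g_j(x,y_1,\dots,y_j,\theta)\le\mu_j(x,y_1,\dots,y_j)(1+|\theta|)\ \ (j=1,\dots,m-1).$$ **Theorem (DADS controller for systems in parametric strict feedback form).** For all constants $b,\Gamma,\varepsilon,c,a>0$ and all smooth $\kappa,\lambda:\mathbb{R}_+\to\mathbb{R}_+$ of class $K_\infty$ (continuous, strictly increasing, zero at zero, unbounded) there exist functions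 $k,V\in C^\infty(\mathbb{R}^n\times\mathbb{R}^m\times\mathbb{R})$ with $V(0,0,z)=k(0,0,z)=0$ for all $z\in\mathbb{R}$ and $V(x,y,z)>0$ for all $(x,y)\ne 0$, $z\in\mathbb{R}$, a constant $M\ge 1$ and a continuous function $B:\mathbb{R}^n\times\mathbb{R}^m\times\mathbb{R}\times\mathbb{R}_+\times\mathbb{R}_+\to\mathbb{R}$ such that for every $(x_0,y_0,z_0)\in\mathbb{R}^n\times\mathbb{R}^m\times\mathbb{R}$, $d\in L^\infty(\mathbb{R}_+;\mathbb{R}^l)$ and $\theta\in L^\infty(\mathbb{R}_+;\Theta)$ the (Carathéodory) solution of the system in closed loop with $$u=k(x,y,z),\qquad \dot z=\Gamma e^{-z}\Big(V(x,y,z)-\frac{\varepsilon^2}{2M}\Big)^+,\qquad (x(0),y(0),z(0))=(x_0,y_0,z_0)$$ is unique, exists for all $t\ge 0$, and satisfies: $$\limsup_{t\to+\infty}\big(|x(t)|+|y_1(t)|\big)\le\varepsilon,\qquad \limsup_{t\to+\infty}V(x(t),y(t),z(t))\le\frac{\varepsilon^2}{2M};$$ the limit $\lim_{s\to+\infty}z(s)$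 exists and is finite; and, for all $t\ge 0$, $$z_0\le z(t)\le\lim_{s\to+\infty}z(s)\le B(x_0,y_0,z_0,\|d\|_\infty,\|\theta\|_\infty),$$ $$|x(t)|+|y(t)|\le B(x_0,y_0,z_0,\|d\|_\infty,\|\theta\|_\infty),$$ $$|x(t)|^2+|y_1(t)|^2\le M\,V(x(t),y(t),z(t))\le M e^{-ct}\,V(x_0,y_0,z_0)+a\,\frac{\|d\|_\infty^2+\big((\|\theta\|_\infty-b-\lambda(e^{z_0}))^+\big)^2}{c\,(1+\kappa(e^{z_0}))}.$$ Moreover, if $\lim_{t\to+\infty}d(t)=0$ and $\limsup_{t\to+\infty}|\theta(t)|\le b+\lambda\big(e^{\lim_{t\to+\infty}z(t)}\big)$ (limit and limit superior may be taken disregarding null sets of times), then $\lim_{t\to+\infty}\big(|x(t)|+|y(t)|\big)=0$. -/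

import Mathlib

open Set Filter Topology MeasureTheory
open scoped NNReal ContDiff

noncomputable section

namespace DADS

/-- `ℝᵏ` with its Euclidean norm. -/
abbrev Vec (k : ℕ) : Type := EuclideanSpace ℝ (Fin k)

/-- The space `ℝⁿ × ℝᵐ × ℝ` of the closed-loop states `(x, y, z)`. -/
abbrev State (n m : ℕ) : Type := Vec n × Vec m × ℝ

/-- The essential supremum norm `‖d‖_∞` of a function on `[0, ∞)`. -/
def supNorm {k : ℕ} (d : ℝ → Vec k) : ℝ≥0 :=
  (eLpNorm d ⊤ (volume.restrict (Ici (0 : ℝ)))).toNNReal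

/-- `d ∈ L^∞(ℝ₊; S)`: Lebesgue measurable, essentially bounded, with values in `S`
(values at negative times are irrelevant). -/
structure IsLInf {k : ℕ} (S : Set (Vec k)) (d : ℝ → Vec k) : Prop where
  memLp : MemLp d ⊤ (volume.restrict (Ici (0 : ℝ)))
  mem : ∀ t : ℝ, 0 ≤ t → d t ∈ S

/-- Time tending to `+∞`, null sets of times being disregarded. -/
def essAtTop : Filter ℝ := atTop ⊓ ae (volume : Measure ℝ)

/-- A smooth function of class `K_∞` on `[0, ∞)` (only the values on `[0, ∞)` matter). -/
structure IsSmoothKInf (κ : ℝ → ℝ) : Prop where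
  smooth : ContDiffOn ℝ ∞ κ (Ici 0)
  strictMono : StrictMonoOn κ (Ici 0)
  zero : κ 0 = 0
  tendsto : Tendsto κ atTop atTop

/-- The truncation `(y₁, …, y_{j+1})` of `y ∈ ℝᵐ`, for the zero-based index `j`. -/
def trunc {m : ℕ} (j : Fin m) (y : Vec m) : Vec (j + 1) :=
  WithLp.toLp 2 fun i : Fin (j + 1) => y (Fin.castLE j.isLt i)

/-- The mappings defining a system in parametric strict feedback form. Indices are zero-based:
the index `j : Fin m` stands for the `(j+1)`-st equation, whose mappings have the arguments
`(x, (y₁, …, y_{j+1})) ∈ ℝⁿ × ℝʲ⁺¹`. -/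
structure System (n m p l : ℕ) where
  h : (j : Fin m) → Vec n × Vec (j + 1) → ℝ
  g : (j : Fin m) → (Vec n × Vec (j + 1)) × Vec p → ℝ
  φ : (j : Fin m) → Vec n × Vec (j + 1) → Vec p
  α : (j : Fin m) → Vec n × Vec (j + 1) → Vec l

namespace System

variable {n m p l : ℕ}

/-- The regularity assumptions on the mappings of the system. The last one is automatic
(by compactness, from `smooth_g`) when `Θ` is closed. -/
structure IsRegular (S : System n m p l) (Θ : Set (Vec p)) : Prop where
  smooth_h : ∀ j, ContDiff ℝ ∞ (S.h j)
  smooth_g : ∀ j, ContDiffOn ℝ ∞ (S.g j) (univ ×ˢ Θ)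
  smooth_φ : ∀ j, ContDiff ℝ ∞ (S.φ j)
  smooth_α : ∀ j, ContDiff ℝ ∞ (S.α j)
  h_zero : ∀ j, S.h j 0 = 0
  φ_zero : ∀ j, S.φ j 0 = 0
  locLip_g : ∀ j : Fin m, ∀ R : ℝ, ∃ L : ℝ, ∀ ξ ξ' : Vec n × Vec (j + 1), ∀ θ ∈ Θ,
    ‖ξ‖ ≤ R → ‖ξ'‖ ≤ R → ‖θ‖ ≤ R →
      |S.g j (ξ, θ)| ≤ L ∧ |S.g j (ξ, θ) - S.g j (ξ', θ)| ≤ L * ‖ξ - ξ'‖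

/-- There are smooth positive `η_j` (`1 ≤ j ≤ m`) and `μ_j` (`1 ≤ j ≤ m - 1`) with
`η_j ≤ g_j` for `1 ≤ j ≤ m` and `g_j ≤ μ_j (1 + |θ|)` for `1 ≤ j ≤ m - 1`, for all `θ ∈ Θ`. -/
def HasGainBounds (S : System n m p l) (Θ : Set (Vec p)) : Prop :=
  (∀ j : Fin m, ∃ η : Vec n × Vec (j + 1) → ℝ, ContDiff ℝ ∞ η ∧ (∀ ξ, 0 < η ξ) ∧
    ∀ ξ, ∀ θ ∈ Θ, η ξ ≤ S.g j (ξ, θ)) ∧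
  (∀ j : Fin m, (j : ℕ) + 1 < m → ∃ μ : Vec n × Vec (j + 1) → ℝ,
    ContDiff ℝ ∞ μ ∧ (∀ ξ, 0 < μ ξ) ∧ ∀ ξ, ∀ θ ∈ Θ, S.g j (ξ, θ) ≤ μ ξ * (1 + ‖θ‖))

/-- Right-hand side of `ẋ_i = x_{i+1}`, with `x_{n+1} = y₁`. -/
def xDot [NeZero m] (x : Vec n) (y : Vec m) : Vec n :=
  WithLp.toLp 2 fun i : Fin n => if hi : (i : ℕ) + 1 < n then x ⟨i + 1, hi⟩ else y 0

/-- Right-hand side of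
`ẏ_j = h_j + g_j y_{j+1} + φ_j' θ + α_j' d`, with `y_{m+1} = u`. -/
def yDot (S : System n m p l) (x : Vec n) (y : Vec m) (u : ℝ) (θ : Vec p) (d : Vec l) : Vec m :=
  WithLp.toLp 2 fun j : Fin m =>
    S.h j (x, trunc j y)
      + S.g j ((x, trunc j y), θ) * (if hj : (j : ℕ) + 1 < m then y ⟨j + 1, hj⟩ else u)
      + inner ℝ (S.φ j (x, trunc j y)) θ
      + inner ℝ (S.α j (x, trunc j y)) d

/-- The closed-loop vector field with `u = k(x, y, z)` and
`ż = Γ e^{-z} (V(x, y, z) - ε² / (2 M))⁺`. -/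
def closedLoop [NeZero m] (S : System n m p l) (k V : State n m → ℝ) (Γ ε M : ℝ)
    (θ : Vec p) (d : Vec l) (w : State n m) : State n m :=
  (xDot w.1 w.2.1,
   S.yDot w.1 w.2.1 (k w) θ d,
   Γ * Real.exp (-w.2.2) * max (V w - ε ^ 2 / (2 * M)) 0)

end System

/-- `w` is a (Carathéodory) solution on `[0, T]` of `ẇ(t) = F t (w t)`, `w(0) = w₀`. -/
structure IsSolutionOn {n m : ℕ} (F : ℝ → State n m → State n m) (w₀ : State n m) (T : ℝ)
    (w : ℝ → State n m) : Prop where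
  continuousOn : ContinuousOn w (Icc 0 T)
  integrable : IntervalIntegrable (fun s => F s (w s)) volume 0 T
  eq : ∀ t ∈ Icc 0 T, w t = w₀ + ∫ s in (0 : ℝ)..t, F s (w s)

/-- `w` is the unique solution of `ẇ(t) = F t (w t)`, `w(0) = w₀`, and exists for all `t ≥ 0`:
it solves the problem on every `[0, T]`, and every solution on some `[0, T]` agrees with it. -/
def IsUniqueGlobalSolution {n m : ℕ} (F : ℝ → State n m → State n m) (w₀ : State n m)
    (w : ℝ → State n m) : Prop :=
  (∀ T : ℝ, 0 < T → IsSolutionOn F w₀ T w) ∧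
  ∀ T : ℝ, 0 < T → ∀ v : ℝ → State n m, IsSolutionOn F w₀ T v → EqOn v w (Icc 0 T)

end DADS

end

/-!
The feedback is built by backstepping, and everything claimed about the closed loop follows from a
single dissipation inequality for the function `V` that comes with it:

  `V̇ ≤ -c V + (a / M) (|d|² + ((|θ| - b - λ(e^z))⁺)²) / (1 + κ(e^z))`,

together with `|x|² + |y₁|² ≤ M V` and properness of `V` in `(x, y)`, locally uniformly in `z`
(`IsLyapunovPair`).

**Construction of `k` and `V`.** The integrator chain is written in linear coordinates `s₀, s₁, …`
with `ṡ_i = s_{i+1} - ρ s_i - s_{i-1}`. The skew coupling cancels in the derivative of `½ ∑ s_i²`,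
which is the first Lyapunov function (`exists_chain_lyapunov`). Each further stage adds `½ e²`
with `e = y_{j+1} - k_j` and takes `k_{j+1} = -e K` with a large smooth gain `K` depending on
`(x, y₁, …, y_{j+1}, z)` (`IsStage.exists_succ`). The cross terms are bounded by
`|e| C (√V (1 + |θ|) + |d| + ż)`. Here `|θ| ≤ b + λ(e^z) + (|θ| - b - λ(e^z))⁺`, and `b + λ(e^z)` is
a known function of the state, so Young's inequality leaves a fixed multiple of `V`, at the expense
of the decay rate, an arbitrarily small multiple of the disturbance term divided by `1 + κ(e^z)`,
and a multiple of `e²`, which `K` dominates because `g_j ≥ η_j > 0`. The part of `ż` is harmless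
since `ż ≤ Γ e^{-z} V`; as `V` is here the final function, every stage keeps track of a variable
`E ≥ 0` for what later stages add. The gain has to be smooth whereas the bounds are only continuous;
`exists_contDiff_ge` bridges the gap.

**Consequences.** Since `z` does not decrease, the dissipation inequality integrates to the
exponential estimate (`IsLyapunovPair.decay`), which bounds `V`. Let `τ` be the time from which `z`
is so large that the disturbance term is below `c ε² / (2 M)`. After `τ` the deadzone makes `ż` at
most `Γ e^{-z} V(τ) e^{-c(t-τ)}`, which is integrable; this bounds `z`, and then the state, in terms
of the data (`IsLyapunovPair.exists_bound`). A continuous bound `B` is obtained from locally constant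
ones by a partition of unity. As `z` converges, the integral of `(V - ε² / (2 M))⁺` is finite, and
because `V̇` is bounded above this forces `limsup V ≤ ε² / (2 M)` (`IsLyapunovPair.eventually_le`).
If the disturbance term tends to zero, so does `V`, hence `(x, y)` (`IsLyapunovPair.tendsto_V`,
`IsLyapunovPair.tendsto_of_tendsto_V`).

**Existence of solutions.** A vector field that is locally bounded and locally Lipschitz in the
state, uniformly in time, and measurable in time (`IsCaratheodory`) is cut off outside a large
ball; the Picard operator of the truncated field is a contraction for an exponentially weighted
sup norm, and an a priori bound removes the cut-off (`IsCaratheodory.exists_global`).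
-/

namespace DADS

/-! ### Carathéodory differential equations -/

/-- Global existence for an integral equation whose right-hand side is bounded and globally
Lipschitz in the state, and merely measurable in time. The Picard operator is a contraction for the
weighted norm `sup e^{-2Lt} ‖w t‖`. -/
theorem exists_integral_solution {E : Type*} [NormedAddCommGroup E] [NormedSpace ℝ E]
    [CompleteSpace E] (G : ℝ → E → E) {L : ℝ} (hL : 0 < L) (hb : ∀ t v, ‖G t v‖ ≤ L)
    (hlip : ∀ t v v', ‖G t v - G t v'‖ ≤ L * ‖v - v'‖)
    (hmeas : ∀ v : ℝ → E, Continuous v → AEStronglyMeasurable (fun s => G s (v s)) volume)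
    (w₀ : E) :
    ∃ w : ℝ → E, Continuous w ∧ ∀ t, 0 ≤ t → w t = w₀ + ∫ s in (0 : ℝ)..t, G s (w s) := by
  have hint : ∀ v : ℝ → E, Continuous v → ∀ a b : ℝ,
      IntervalIntegrable (fun s => G s (v s)) volume a b := by
    intro v hv a b
    refine (intervalIntegrable_const (c := L)).mono_fun (hmeas v hv).restrict ?_
    exact ae_of_all _ fun s => (hb _ _).trans (le_abs_self L)
  let ex : (BoundedContinuousFunction ℝ E) → ℝ → E := fun u s => Real.exp (2 * L * s) • u s
  have hex : ∀ u, Continuous (ex u) := fun u => by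
    have := u.continuous
    fun_prop
  let Pf : (BoundedContinuousFunction ℝ E) → ℝ → E := fun u t =>
    Real.exp (-(2 * L * max t 0)) • (w₀ + ∫ s in (0 : ℝ)..(max t 0), G s (ex u s))
  have hPc : ∀ u, Continuous (Pf u) := by
    intro u
    have h1 : Continuous fun t : ℝ => ∫ s in (0 : ℝ)..t, G s (ex u s) :=
      intervalIntegral.continuous_primitive (fun a b => hint _ (hex u) a b) 0
    have h2 : Continuous fun t : ℝ => ∫ s in (0 : ℝ)..(max t 0), G s (ex u s) :=
      h1.comp (by fun_prop : Continuous fun t : ℝ => max t 0)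
    fun_prop
  have hPb : ∀ u t, ‖Pf u t‖ ≤ ‖w₀‖ + 1 := by
    intro u t
    have ht : 0 ≤ max t 0 := le_max_right _ _
    have h1 : ‖∫ s in (0 : ℝ)..(max t 0), G s (ex u s)‖ ≤ L * |max t 0 - 0| :=
      intervalIntegral.norm_integral_le_of_norm_le_const fun s _ => hb _ _
    rw [sub_zero, abs_of_nonneg ht] at h1
    have h2 : L * max t 0 ≤ Real.exp (2 * L * max t 0) := by
      have := Real.add_one_le_exp (2 * L * max t 0)
      nlinarith [mul_nonneg hL.le ht]
    have h3 : 1 ≤ Real.exp (2 * L * max t 0) := Real.one_le_exp (by positivity)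
    have h4 : ‖w₀ + ∫ s in (0 : ℝ)..(max t 0), G s (ex u s)‖
        ≤ Real.exp (2 * L * max t 0) * (‖w₀‖ + 1) := by
      refine (norm_add_le _ _).trans ?_
      nlinarith [norm_nonneg w₀]
    simp only [Pf]
    rw [norm_smul, Real.norm_of_nonneg (Real.exp_pos _).le, Real.exp_neg,
      inv_mul_le_iff₀ (Real.exp_pos _)]
    exact h4
  let P : (BoundedContinuousFunction ℝ E) → (BoundedContinuousFunction ℝ E) := fun u =>
    BoundedContinuousFunction.ofNormedAddCommGroup (Pf u) (hPc u) (‖w₀‖ + 1) (hPb u)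
  have hP : ContractingWith (1 / 2 : ℝ≥0) P := by
    refine ⟨by
      rw [← NNReal.coe_lt_coe]; push_cast; norm_num, LipschitzWith.of_dist_le_mul fun u v => ?_⟩
    rw [BoundedContinuousFunction.dist_le (by positivity)]
    intro t
    have ht : 0 ≤ max t 0 := le_max_right _ _
    change dist (Pf u t) (Pf v t) ≤ _
    rw [dist_eq_norm]
    simp only [Pf]
    rw [← smul_sub, add_sub_add_left_eq_sub,
      ← intervalIntegral.integral_sub (hint _ (hex u) _ _) (hint _ (hex v) _ _), norm_smul,
      Real.norm_of_nonneg (Real.exp_pos _).le, Real.exp_neg, inv_mul_le_iff₀ (Real.exp_pos _)]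
    have h1 : ‖∫ s in (0 : ℝ)..(max t 0), (G s (ex u s) - G s (ex v s))‖
        ≤ ∫ s in (0 : ℝ)..(max t 0), (L * dist u v) * Real.exp (2 * L * s) := by
      refine intervalIntegral.norm_integral_le_of_norm_le ht (ae_of_all _ fun s _ => ?_)
        (Continuous.intervalIntegrable (by fun_prop) _ _)
      refine (hlip _ _ _).trans ?_
      simp only [ex]
      rw [← smul_sub, norm_smul, Real.norm_of_nonneg (Real.exp_pos _).le, ← dist_eq_norm]
      have := u.dist_coe_le_dist (g := v) s
      have h5 := mul_le_mul_of_nonneg_left this (mul_pos hL (Real.exp_pos (2 * L * s))).le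
      nlinarith
    refine h1.trans ?_
    have h2 : ∫ s in (0 : ℝ)..(max t 0), (L * dist u v) * Real.exp (2 * L * s)
        = dist u v / 2 * (Real.exp (2 * L * max t 0) - 1) := by
      have hd : ∀ s ∈ uIcc 0 (max t 0), HasDerivAt
          (fun s => dist u v / 2 * Real.exp (2 * L * s))
          ((L * dist u v) * Real.exp (2 * L * s)) s := by
        intro s _
        have h0 : HasDerivAt (fun s : ℝ => 2 * L * s) (2 * L) s := by
          simpa using (hasDerivAt_id s).const_mul (2 * L)
        exact (h0.exp.const_mul (dist u v / 2)).congr_deriv (by ring)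
      rw [intervalIntegral.integral_eq_sub_of_hasDerivAt hd
        (Continuous.intervalIntegrable (by fun_prop) _ _), mul_zero, Real.exp_zero]
      ring
    rw [h2]
    push_cast
    have := dist_nonneg (x := u) (y := v)
    nlinarith
  obtain ⟨u, hu⟩ : ∃ u, P u = u := ⟨_, hP.fixedPoint_isFixedPt⟩
  refine ⟨ex u, hex u, fun t ht => ?_⟩
  have h1 : Pf u t = u t := congrArg (fun f : BoundedContinuousFunction ℝ E => f t) hu
  simp only [Pf, max_eq_left ht] at h1
  change Real.exp (2 * L * t) • u t = _
  rw [← h1, smul_smul, ← Real.exp_add]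
  simp

/-- A Gronwall inequality in integral form. -/
theorem eq_zero_of_le_integral {f : ℝ → ℝ} {T L : ℝ} (hT : 0 ≤ T) (hL : 0 < L)
    (hf : ContinuousOn f (Icc 0 T)) (h0 : ∀ t ∈ Icc 0 T, 0 ≤ f t)
    (h : ∀ t ∈ Icc 0 T, f t ≤ ∫ s in (0 : ℝ)..t, L * f s) : ∀ t ∈ Icc 0 T, f t = 0 := by
  have hc : ContinuousOn (fun t => Real.exp (-(2 * L * t)) * f t) (Icc 0 T) :=
    ContinuousOn.mul (Continuous.continuousOn (by fun_prop)) hf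
  obtain ⟨τ, hτ, hmax⟩ := isCompact_Icc.exists_isMaxOn (nonempty_Icc.2 hT) hc
  set A := Real.exp (-(2 * L * τ)) * f τ with hA
  have hA0 : 0 ≤ A := mul_nonneg (Real.exp_pos _).le (h0 τ hτ)
  have hle : ∀ s ∈ Icc 0 T, f s ≤ A * Real.exp (2 * L * s) := by
    intro s hs
    have h1 : Real.exp (-(2 * L * s)) * f s ≤ A := hmax hs
    rwa [Real.exp_neg, inv_mul_le_iff₀ (Real.exp_pos _), mul_comm] at h1
  have h1 : f τ ≤ A / 2 * (Real.exp (2 * L * τ) - 1) := by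
    refine (h τ hτ).trans ?_
    have hsub : Icc 0 τ ⊆ Icc 0 T := Icc_subset_Icc_right hτ.2
    have h2 : ∫ s in (0 : ℝ)..τ, L * f s ≤ ∫ s in (0 : ℝ)..τ, L * (A * Real.exp (2 * L * s)) := by
      refine intervalIntegral.integral_mono_on hτ.1 ?_
        (Continuous.intervalIntegrable (by fun_prop) _ _) fun s hs =>
          mul_le_mul_of_nonneg_left (hle s (hsub hs)) hL.le
      exact ContinuousOn.intervalIntegrable_of_Icc hτ.1 ((hf.mono hsub).const_smul L)
    refine h2.trans (le_of_eq ?_)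
    have hd : ∀ s ∈ uIcc 0 τ, HasDerivAt (fun s => A / 2 * Real.exp (2 * L * s))
        (L * (A * Real.exp (2 * L * s))) s := by
      intro s _
      have h0 : HasDerivAt (fun s : ℝ => 2 * L * s) (2 * L) s := by
        simpa using (hasDerivAt_id s).const_mul (2 * L)
      exact (h0.exp.const_mul (A / 2)).congr_deriv (by ring)
    rw [intervalIntegral.integral_eq_sub_of_hasDerivAt hd
      (Continuous.intervalIntegrable (by fun_prop) _ _), mul_zero, Real.exp_zero]
    ring
  have h2 : A ≤ A / 2 := by
    have h3 : A = Real.exp (-(2 * L * τ)) * f τ := hA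
    rw [Real.exp_neg] at h3
    have h4 : f τ = Real.exp (2 * L * τ) * A := by
      rw [h3, mul_inv_cancel_left₀ (Real.exp_pos _).ne']
    have h5 := Real.exp_pos (2 * L * τ)
    rw [h4] at h1
    have h6 : Real.exp (2 * L * τ) * A ≤ Real.exp (2 * L * τ) * (A / 2) := by nlinarith
    exact le_of_mul_le_mul_left h6 h5
  have hA1 : A = 0 := by linarith
  intro t ht
  have := hle t ht
  rw [hA1, zero_mul] at this
  exact le_antisymm this (h0 t ht)

/-- The hypotheses of Carathéodory's theorem on a half-line: measurability in time, and, on every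
ball, bounds and Lipschitz constants that do not depend on the time. -/
structure IsCaratheodory {n m : ℕ} (F : ℝ → State n m → State n m) : Prop where
  lip : ∀ R : ℝ, ∃ L : ℝ, ∀ᵐ t ∂(volume.restrict (Ici (0 : ℝ))), ∀ v v' : State n m,
    ‖v‖ ≤ R → ‖v'‖ ≤ R → ‖F t v‖ ≤ L ∧ ‖F t v - F t v'‖ ≤ L * ‖v - v'‖
  meas : ∀ v : ℝ → State n m, Continuous v →
    AEStronglyMeasurable (fun s => F s (v s)) (volume.restrict (Ici (0 : ℝ)))

theorem ae_restrict_uIoc {P : ℝ → Prop} (h : ∀ᵐ t ∂(volume.restrict (Ici (0 : ℝ))), P t) {a b : ℝ}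
    (ha : 0 ≤ a) (hb : 0 ≤ b) : ∀ᵐ t, t ∈ uIoc a b → P t := by
  rw [ae_restrict_iff' measurableSet_Ici] at h
  filter_upwards [h] with t ht hab
  exact ht ((le_min ha hb).trans hab.1.le)

theorem IsSolutionOn.mono {n m : ℕ} {F : ℝ → State n m → State n m} {w₀ : State n m} {T T' : ℝ}
    {w : ℝ → State n m} (h : IsSolutionOn F w₀ T w) (h0 : 0 ≤ T') (hT : T' ≤ T) :
    IsSolutionOn F w₀ T' w where
  continuousOn := h.continuousOn.mono (Icc_subset_Icc_right hT)
  integrable := h.integrable.mono_set (by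
    rw [uIcc_of_le h0, uIcc_of_le (h0.trans hT)]; exact Icc_subset_Icc_right hT)
  eq := fun t ht => h.eq t ⟨ht.1, ht.2.trans hT⟩

theorem IsSolutionOn.exists_bound {n m : ℕ} {F : ℝ → State n m → State n m} {w₀ : State n m}
    {T : ℝ} {w : ℝ → State n m} (h : IsSolutionOn F w₀ T w) : ∃ R, ∀ t ∈ Icc 0 T, ‖w t‖ ≤ R :=
  isCompact_Icc.exists_bound_of_continuousOn h.continuousOn

theorem IsCaratheodory.unique {n m : ℕ} {F : ℝ → State n m → State n m} (hF : IsCaratheodory F)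
    {w₀ : State n m} {T : ℝ} {v w : ℝ → State n m} (hT : 0 ≤ T)
    (hv : IsSolutionOn F w₀ T v) (hw : IsSolutionOn F w₀ T w) : EqOn v w (Icc 0 T) := by
  obtain ⟨R₁, hR₁⟩ := hv.exists_bound
  obtain ⟨R₂, hR₂⟩ := hw.exists_bound
  obtain ⟨L, hL⟩ := hF.lip (max R₁ R₂)
  have key : ∀ t ∈ Icc 0 T, ‖v t - w t‖ = 0 := by
    refine eq_zero_of_le_integral (L := max L 1) hT (by positivity)
      (hv.continuousOn.sub hw.continuousOn).norm (fun t _ => norm_nonneg _) fun t ht => ?_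
    have hvt := (hv.mono ht.1 ht.2).integrable
    have hwt := (hw.mono ht.1 ht.2).integrable
    rw [hv.eq t ht, hw.eq t ht, add_sub_add_left_eq_sub, ← intervalIntegral.integral_sub hvt hwt]
    have hsub : Icc 0 t ⊆ Icc 0 T := Icc_subset_Icc_right ht.2
    refine intervalIntegral.norm_integral_le_of_norm_le ht.1 ?_ ?_
    · filter_upwards [ae_restrict_uIoc hL le_rfl ht.1] with s hs hs'
      have hs1 : s ∈ Icc 0 T := hsub ⟨hs'.1.le, hs'.2⟩
      rw [uIoc_of_le ht.1] at hs
      refine ((hs hs' _ _ ((hR₁ s hs1).trans (le_max_left _ _))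
        ((hR₂ s hs1).trans (le_max_right _ _))).2).trans ?_
      exact mul_le_mul_of_nonneg_right (le_max_left _ _) (norm_nonneg _)
    · exact ContinuousOn.intervalIntegrable_of_Icc ht.1
        (((hv.continuousOn.sub hw.continuousOn).norm.mono hsub).const_smul (max L 1))
  intro t ht
  exact sub_eq_zero.1 (norm_eq_zero.1 (key t ht))

/-- Global existence and uniqueness from an a priori bound `C` on the solutions. The right-hand side
is cut off outside a ball slightly larger than the one of radius `C`, and the solution of the
modified equation never reaches the region where the modification is active. -/
theorem IsCaratheodory.exists_global {n m : ℕ} {F : ℝ → State n m → State n m}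
    (hF : IsCaratheodory F) (w₀ : State n m) (C : ℝ) (hC0 : ‖w₀‖ ≤ C)
    (hC : ∀ T : ℝ, 0 < T → ∀ v, IsSolutionOn F w₀ T v → ∀ t ∈ Icc 0 T, ‖v t‖ ≤ C) :
    ∃ w : ℝ → State n m, Continuous w ∧ IsUniqueGlobalSolution F w₀ w := by
  obtain ⟨L, hL⟩ := hF.lip (C + 2)
  set S : Set ℝ := {t | 0 ≤ t ∧ ∀ v v' : State n m, ‖v‖ ≤ C + 2 → ‖v'‖ ≤ C + 2 →
    ‖F t v‖ ≤ L ∧ ‖F t v - F t v'‖ ≤ L * ‖v - v'‖} with hS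
  let χ : State n m → ℝ := fun v => max 0 (min 1 (C + 2 - ‖v‖))
  have hχ0 : ∀ v, 0 ≤ χ v := fun v => le_max_left _ _
  have hχ1 : ∀ v, χ v ≤ 1 := fun v => max_le zero_le_one (min_le_left _ _)
  have hχC : Continuous χ := by fun_prop
  have hχin : ∀ v, ‖v‖ ≤ C + 1 → χ v = 1 := fun v hv => by
    simp only [χ]; rw [min_eq_left (by linarith), max_eq_right zero_le_one]
  have hχout : ∀ v, C + 2 < ‖v‖ → χ v = 0 := fun v hv => by
    simp only [χ]; exact max_eq_left ((min_le_right _ _).trans (by linarith))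
  have hχL : ∀ v v', |χ v - χ v'| ≤ ‖v - v'‖ := by
    intro v v'
    refine (abs_max_sub_max_le_max _ _ _ _).trans ?_
    rw [sub_self, abs_zero]
    refine max_le (norm_nonneg _) ((abs_min_sub_min_le_max _ _ _ _).trans ?_)
    rw [sub_self, abs_zero]
    refine max_le (norm_nonneg _) ?_
    have h1 : C + 2 - ‖v‖ - (C + 2 - ‖v'‖) = -(‖v‖ - ‖v'‖) := by ring
    rw [h1, abs_neg]
    exact abs_norm_sub_norm_le v v'
  classical
  let G : ℝ → State n m → State n m := fun t v => if t ∈ S then χ v • F t v else 0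
  set K := max L 0 with hK
  have hK0 : 0 ≤ K := le_max_right _ _
  have hLK : L ≤ K := le_max_left _ _
  have hFb : ∀ t ∈ S, ∀ v, ‖v‖ ≤ C + 2 → ‖F t v‖ ≤ K := fun t ht v hv =>
    ((ht.2 v v hv hv).1).trans hLK
  have hGb : ∀ t v, ‖G t v‖ ≤ K := by
    intro t v
    by_cases ht : t ∈ S
    · simp only [G, if_pos ht]
      rw [norm_smul, Real.norm_of_nonneg (hχ0 v)]
      by_cases hv : ‖v‖ ≤ C + 2
      · exact (mul_le_of_le_one_left (norm_nonneg _) (hχ1 v)).trans (hFb t ht v hv)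
      · rw [hχout v (not_le.1 hv), zero_mul]; exact hK0
    · simp only [G, if_neg ht, norm_zero]; exact hK0
  have hGL : ∀ t v v', ‖G t v - G t v'‖ ≤ 2 * K * ‖v - v'‖ := by
    intro t v v'
    by_cases ht : t ∈ S
    · simp only [G, if_pos ht]
      by_cases hv : ‖v‖ ≤ C + 2
      · by_cases hv' : ‖v'‖ ≤ C + 2
        · have e1 : χ v • F t v - χ v' • F t v' =
              χ v • (F t v - F t v') + (χ v - χ v') • F t v' := by
            rw [smul_sub, sub_smul]; abel
          rw [e1]
          refine (norm_add_le _ _).trans ?_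
          rw [norm_smul, norm_smul, Real.norm_of_nonneg (hχ0 v), Real.norm_eq_abs]
          have h1 : χ v * ‖F t v - F t v'‖ ≤ K * ‖v - v'‖ :=
            (mul_le_of_le_one_left (norm_nonneg _) (hχ1 v)).trans
              (((ht.2 v v' hv hv').2).trans (mul_le_mul_of_nonneg_right hLK (norm_nonneg _)))
          have h2 : |χ v - χ v'| * ‖F t v'‖ ≤ ‖v - v'‖ * K :=
            mul_le_mul (hχL v v') (hFb t ht v' hv') (norm_nonneg _) (norm_nonneg _)
          linarith
        · have h3 : χ v' = 0 := hχout v' (not_le.1 hv')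
          rw [h3, zero_smul, sub_zero, norm_smul, Real.norm_of_nonneg (hχ0 v)]
          have h4 := hχL v v'
          rw [h3, sub_zero, abs_of_nonneg (hχ0 v)] at h4
          have h2 := mul_le_mul h4 (hFb t ht v hv) (norm_nonneg _) (norm_nonneg _)
          nlinarith [mul_nonneg hK0 (norm_nonneg (v - v'))]
      · have h3 : χ v = 0 := hχout v (not_le.1 hv)
        by_cases hv' : ‖v'‖ ≤ C + 2
        · rw [h3, zero_smul, zero_sub, norm_neg, norm_smul, Real.norm_of_nonneg (hχ0 v')]
          have h4 := hχL v v'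
          rw [h3, zero_sub, abs_neg, abs_of_nonneg (hχ0 v')] at h4
          have h2 := mul_le_mul h4 (hFb t ht v' hv') (norm_nonneg _) (norm_nonneg _)
          nlinarith [mul_nonneg hK0 (norm_nonneg (v - v'))]
        · rw [h3, hχout v' (not_le.1 hv')]
          simp; positivity
    · simp only [G, if_neg ht, sub_zero, norm_zero]; positivity
  have hmemS : ∀ᵐ t ∂(volume.restrict (Ici (0 : ℝ))), t ∈ S := by
    filter_upwards [hL, ae_restrict_mem measurableSet_Ici] with t h1 h2 using ⟨h2, h1⟩
  have hSc : ∀ᵐ t ∂(volume.restrict (Iio (0 : ℝ))), t ∉ S := by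
    filter_upwards [ae_restrict_mem measurableSet_Iio] with t h2 h3
    exact absurd h3.1 (not_le.2 h2)
  have hmeas : ∀ v : ℝ → State n m, Continuous v →
      AEStronglyMeasurable (fun s => G s (v s)) volume := by
    intro v hv
    have huniv : (Iio (0 : ℝ)) ∪ Ici 0 = univ := Iio_union_Ici
    rw [← Measure.restrict_univ (μ := (volume : Measure ℝ)), ← huniv,
      aestronglyMeasurable_union_iff]
    constructor
    · refine (aestronglyMeasurable_const (b := (0 : State n m))).congr ?_
      filter_upwards [hSc] with t ht
      simp only [G, if_neg ht]
    · refine AEStronglyMeasurable.congr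
        ((hχC.comp hv).aestronglyMeasurable.smul (hF.meas v hv)) ?_
      filter_upwards [hmemS] with t ht
      simp only [G, if_pos ht]
      rfl
  obtain ⟨w, hwc, hw⟩ := exists_integral_solution G (L := 2 * K + 1) (by positivity)
    (fun t v => (hGb t v).trans (by linarith))
    (fun t v v' => (hGL t v v').trans
      (mul_le_mul_of_nonneg_right (by linarith) (norm_nonneg _))) hmeas w₀
  have hw0 : w 0 = w₀ := by simpa using hw 0 le_rfl
  -- as long as the solution stays in the region where the cut-off is inactive, it solves `F`
  have hsol : ∀ T : ℝ, 0 ≤ T → (∀ t ∈ Icc 0 T, ‖w t‖ ≤ C + 1) → IsSolutionOn F w₀ T w := by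
    intro T hT hwT
    have hae : ∀ᵐ s, s ∈ uIoc 0 T → G s (w s) = F s (w s) := by
      filter_upwards [ae_restrict_uIoc hmemS le_rfl hT] with s hs hs'
      have h1 := hs hs'
      rw [uIoc_of_le hT] at hs'
      simp only [G, if_pos h1]
      rw [hχin _ (hwT s ⟨hs'.1.le, hs'.2⟩), one_smul]
    refine ⟨hwc.continuousOn, ?_, fun t ht => ?_⟩
    · have h1 : IntervalIntegrable (fun s => G s (w s)) volume 0 T :=
        (intervalIntegrable_const (c := K)).mono_fun (hmeas w hwc).restrict
          (ae_of_all _ fun s => (hGb _ _).trans (le_abs_self K))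
      refine h1.congr_ae ?_
      rw [EventuallyEq, ae_restrict_iff' measurableSet_uIoc]
      exact hae
    · rw [hw t ht.1]
      congr 1
      refine intervalIntegral.integral_congr_ae ?_
      filter_upwards [hae] with s hs hs'
      refine hs ?_
      rw [uIoc_of_le ht.1] at hs'
      rw [uIoc_of_le hT]
      exact ⟨hs'.1, hs'.2.trans ht.2⟩
  have hbound : ∀ t, 0 ≤ t → ‖w t‖ ≤ C + 1 := by
    by_contra! hcon
    obtain ⟨t₁, ht₁, hwt₁⟩ := hcon
    -- the first time at which the norm reaches `C + 1`
    let A : Set ℝ := Icc 0 t₁ ∩ {t | C + 1 ≤ ‖w t‖}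
    have hAc : IsCompact A := isCompact_Icc.inter_right (isClosed_le continuous_const hwc.norm)
    have hAne : A.Nonempty := ⟨t₁, ⟨ht₁, le_rfl⟩, hwt₁.le⟩
    obtain ⟨τ, hτA, hτmin⟩ := hAc.exists_isLeast hAne
    have hτpos : 0 < τ := by
      rcases hτA.1.1.eq_or_lt with h | h
      · have h1 : C + 1 ≤ ‖w τ‖ := hτA.2
        rw [← h, hw0] at h1
        linarith
      · exact h
    have hle : ∀ t ∈ Icc 0 τ, ‖w t‖ ≤ C + 1 := by
      have hlt : ∀ t ∈ Ico 0 τ, ‖w t‖ ≤ C + 1 := by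
        intro t ht
        by_contra! h
        exact absurd (hτmin ⟨⟨ht.1, ht.2.le.trans hτA.1.2⟩, h.le⟩) (not_le.2 ht.2)
      have hcl : closure (Ico 0 τ) ⊆ {t | ‖w t‖ ≤ C + 1} :=
        closure_minimal hlt (isClosed_le hwc.norm continuous_const)
      rwa [closure_Ico hτpos.ne] at hcl
    have h2 := hC τ hτpos w (hsol τ hτpos.le hle) τ ⟨hτpos.le, le_rfl⟩
    have h1 : C + 1 ≤ ‖w τ‖ := hτA.2
    linarith
  have hall : ∀ T : ℝ, 0 < T → IsSolutionOn F w₀ T w := fun T hT =>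
    hsol T hT.le fun t ht => hbound t ht.1
  exact ⟨w, hwc, hall, fun T hT v hv => hF.unique hT.le hv (hall T hT)⟩

/-! ### Regularity of the closed-loop vector field -/

theorem norm_vec_le_sum {k : ℕ} (u : Vec k) : ‖u‖ ≤ ∑ i, |u i| := by
  conv_lhs => rw [← (EuclideanSpace.basisFun (Fin k) ℝ).sum_repr u]
  refine (norm_sum_le _ _).trans (Finset.sum_le_sum fun i _ => ?_)
  rw [norm_smul, (EuclideanSpace.basisFun (Fin k) ℝ).norm_eq_one, mul_one]
  simp

/-- The truncation `y ↦ (y₁, …, y_{j+1})` as a continuous linear map. -/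
noncomputable def truncL {m : ℕ} (j : Fin m) : Vec m →L[ℝ] Vec (j + 1) :=
  LinearMap.toContinuousLinearMap
    { toFun := trunc j
      map_add' := fun y y' => by ext i; simp [trunc]
      map_smul' := fun r y => by ext i; simp [trunc] }

@[simp] theorem truncL_apply {m : ℕ} (j : Fin m) (y : Vec m) : truncL j y = trunc j y := rfl

/-- `(x, y) ↦ ẋ` as a continuous linear map. -/
noncomputable def xDotL (n m : ℕ) [NeZero m] : (Vec n × Vec m) →L[ℝ] Vec n :=
  LinearMap.toContinuousLinearMap
    { toFun := fun q => System.xDot q.1 q.2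
      map_add' := fun q q' => by
        ext i
        simp only [System.xDot, Prod.fst_add, Prod.snd_add, PiLp.add_apply]
        split_ifs <;> rfl
      map_smul' := fun r q => by
        ext i
        simp only [System.xDot, Prod.smul_fst, Prod.smul_snd, PiLp.smul_apply, RingHom.id_apply]
        split_ifs <;> rfl }

@[simp] theorem xDotL_apply {n m : ℕ} [NeZero m] (q : Vec n × Vec m) :
    xDotL n m q = System.xDot q.1 q.2 := rfl

/-- The linear map `(x, y, z) ↦ (x, (y₁, …, y_{j+1}))`. -/
noncomputable def argL (n : ℕ) {m : ℕ} (j : Fin m) : State n m →L[ℝ] Vec n × Vec (j + 1) :=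
  (ContinuousLinearMap.fst ℝ _ _).prod
    ((truncL j).comp ((ContinuousLinearMap.fst ℝ _ _).comp (ContinuousLinearMap.snd ℝ _ _)))

@[simp] theorem argL_apply {n m : ℕ} (j : Fin m) (w : State n m) :
    argL n j w = (w.1, trunc j w.2.1) := rfl

/-- A family of maps, with parameters in `P`, that is bounded and Lipschitz on every ball,
uniformly in the parameter. -/
def UnifLocLip {α E F : Type*} [NormedAddCommGroup E] [NormedAddCommGroup F] (P : Set α)
    (f : α → E → F) : Prop :=
  ∀ R : ℝ, ∃ L : ℝ, 0 ≤ L ∧ ∀ p ∈ P, ∀ v v' : E, ‖v‖ ≤ R → ‖v'‖ ≤ R →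
    ‖f p v‖ ≤ L ∧ ‖f p v - f p v'‖ ≤ L * ‖v - v'‖

namespace UnifLocLip

variable {α E F G : Type*} [NormedAddCommGroup E] [NormedAddCommGroup F] [NormedAddCommGroup G]
  {P : Set α}

theorem of_contDiff [NormedSpace ℝ E] [NormedSpace ℝ F] [FiniteDimensional ℝ E] {f : E → F}
    (hf : ContDiff ℝ 1 f) : UnifLocLip P fun _ => f := by
  intro R
  have : ProperSpace E := FiniteDimensional.proper ℝ E
  obtain ⟨K, hK⟩ := hf.contDiffOn.exists_lipschitzOnWith one_ne_zero
    (convex_closedBall (0 : E) R) (isCompact_closedBall 0 R)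
  obtain ⟨C, hC⟩ := (isCompact_closedBall (0 : E) R).exists_bound_of_continuousOn
    hf.continuous.continuousOn
  refine ⟨max K C, le_max_of_le_left K.2, fun p _ v v' hv hv' => ?_⟩
  have h1 : v ∈ Metric.closedBall (0 : E) R := by simpa using hv
  have h2 : v' ∈ Metric.closedBall (0 : E) R := by simpa using hv'
  refine ⟨(hC v h1).trans (le_max_right _ _), (hK.norm_sub_le h1 h2).trans ?_⟩
  exact mul_le_mul_of_nonneg_right (le_max_left _ _) (norm_nonneg _)

theorem of_bounded {f : α → F} {C : ℝ} (hf : ∀ p ∈ P, ‖f p‖ ≤ C) :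
    UnifLocLip (E := E) P fun p _ => f p := by
  intro R
  refine ⟨max C 0, le_max_right _ _, fun p hp v v' _ _ => ⟨(hf p hp).trans (le_max_left _ _), ?_⟩⟩
  rw [sub_self, norm_zero]
  positivity

theorem add {f g : α → E → F} (hf : UnifLocLip P f) (hg : UnifLocLip P g) :
    UnifLocLip P fun p v => f p v + g p v := by
  intro R
  obtain ⟨L, hL, h⟩ := hf R
  obtain ⟨L', hL', h'⟩ := hg R
  refine ⟨L + L', by positivity, fun p hp v v' hv hv' => ⟨?_, ?_⟩⟩
  · exact (norm_add_le _ _).trans (add_le_add (h p hp v v' hv hv').1 (h' p hp v v' hv hv').1)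
  · rw [add_sub_add_comm, add_mul]
    exact (norm_add_le _ _).trans (add_le_add (h p hp v v' hv hv').2 (h' p hp v v' hv hv').2)

/-- Products, for any pairing `B` that is biadditive and satisfies `‖B u v‖ ≤ ‖u‖ ‖v‖`. -/
theorem bilin {H : Type*} [NormedAddCommGroup H] {f : α → E → F} {g : α → E → G} (B : F → G → H)
    (hB : ∀ u v, ‖B u v‖ ≤ ‖u‖ * ‖v‖) (hB1 : ∀ u u' v, B (u - u') v = B u v - B u' v)
    (hB2 : ∀ u v v', B u (v - v') = B u v - B u v')
    (hf : UnifLocLip P f) (hg : UnifLocLip P g) :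
    UnifLocLip P fun p v => B (f p v) (g p v) := by
  intro R
  obtain ⟨L, hL, h⟩ := hf R
  obtain ⟨L', hL', h'⟩ := hg R
  refine ⟨max (L * L') (2 * L * L'), by positivity, fun p hp v v' hv hv' => ⟨?_, ?_⟩⟩
  · exact ((hB _ _).trans (mul_le_mul (h p hp v v' hv hv').1 (h' p hp v v' hv hv').1
      (norm_nonneg _) hL)).trans (le_max_left _ _)
  · have e : B (f p v) (g p v) - B (f p v') (g p v') =
        B (f p v - f p v') (g p v) + B (f p v') (g p v - g p v') := by
      rw [hB1, hB2]; abel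
    rw [e]
    refine (norm_add_le _ _).trans ?_
    have h1 := (hB (f p v - f p v') (g p v)).trans (mul_le_mul (h p hp v v' hv hv').2
      (h' p hp v v' hv hv').1 (norm_nonneg _) (by positivity))
    have h2 := (hB (f p v') (g p v - g p v')).trans (mul_le_mul (h p hp v' v hv' hv).1
      (h' p hp v v' hv hv').2 (norm_nonneg _) hL)
    have h3 := mul_le_mul_of_nonneg_right (le_max_right (L * L') (2 * L * L'))
      (norm_nonneg (v - v'))
    nlinarith

theorem mul {f g : α → E → ℝ} (hf : UnifLocLip P f) (hg : UnifLocLip P g) :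
    UnifLocLip P fun p v => f p v * g p v :=
  bilin (fun a b => a * b) (fun u v => (norm_mul u v).le) (fun _ _ _ => sub_mul _ _ _)
    (fun _ _ _ => mul_sub _ _ _) hf hg

theorem inner [InnerProductSpace ℝ F] {f g : α → E → F} (hf : UnifLocLip P f)
    (hg : UnifLocLip P g) : UnifLocLip P fun p v => inner ℝ (f p v) (g p v) :=
  bilin (fun a b => Inner.inner ℝ a b) (fun u v => norm_inner_le_norm u v)
    (fun _ _ _ => inner_sub_left _ _ _) (fun _ _ _ => inner_sub_right _ _ _) hf hg

theorem prodMk {f : α → E → F} {g : α → E → G} (hf : UnifLocLip P f) (hg : UnifLocLip P g) :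
    UnifLocLip P fun p v => (f p v, g p v) := by
  intro R
  obtain ⟨L, hL, h⟩ := hf R
  obtain ⟨L', hL', h'⟩ := hg R
  refine ⟨max L L', by positivity, fun p hp v v' hv hv' => ⟨?_, ?_⟩⟩
  · exact max_le_max (h p hp v v' hv hv').1 (h' p hp v v' hv hv').1
  · rw [Prod.mk_sub_mk, Prod.norm_mk, max_mul_of_nonneg _ _ (norm_nonneg _)]
    exact max_le_max (h p hp v v' hv hv').2 (h' p hp v v' hv hv').2

theorem max_zero {f : α → E → ℝ} (hf : UnifLocLip P f) :
    UnifLocLip P fun p v => max (f p v) 0 := by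
  intro R
  obtain ⟨L, hL, h⟩ := hf R
  refine ⟨L, hL, fun p hp v v' hv hv' => ⟨?_, ?_⟩⟩
  · refine le_trans ?_ (h p hp v v' hv hv').1
    rw [Real.norm_of_nonneg (le_max_right _ _)]
    exact max_le (le_abs_self _) (abs_nonneg _)
  · refine le_trans ?_ (h p hp v v' hv hv').2
    refine (abs_max_sub_max_le_max _ _ _ _).trans ?_
    simp

theorem toLp {k : ℕ} {f : Fin k → α → E → ℝ} (hf : ∀ i, UnifLocLip P (f i)) :
    UnifLocLip P fun p v => (WithLp.toLp 2 fun i => f i p v : Vec k) := by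
  intro R
  choose L hL h using fun i => hf i R
  refine ⟨∑ i, L i, Finset.sum_nonneg fun i _ => hL i, fun p hp v v' hv hv' => ⟨?_, ?_⟩⟩
  · exact (norm_vec_le_sum _).trans (Finset.sum_le_sum fun i _ => (h i p hp v v' hv hv').1)
  · refine (norm_vec_le_sum _).trans ?_
    rw [Finset.sum_mul]
    exact Finset.sum_le_sum fun i _ => (h i p hp v v' hv hv').2

theorem comp_clm [NormedSpace ℝ E] [NormedSpace ℝ F] {f : α → F → G} (hf : UnifLocLip P f)
    (T : E →L[ℝ] F) : UnifLocLip P fun p v => f p (T v) := by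
  intro R
  obtain ⟨L, hL, h⟩ := hf (‖T‖ * R)
  have hT : ∀ v, ‖v‖ ≤ R → ‖T v‖ ≤ ‖T‖ * R := fun v hv =>
    (T.le_opNorm v).trans (mul_le_mul_of_nonneg_left hv (norm_nonneg _))
  refine ⟨max L (L * ‖T‖), by positivity, fun p hp v v' hv hv' => ⟨?_, ?_⟩⟩
  · exact ((h p hp _ _ (hT v hv) (hT v' hv')).1).trans (le_max_left _ _)
  · refine ((h p hp _ _ (hT v hv) (hT v' hv')).2).trans ?_
    rw [← map_sub]
    refine (mul_le_mul_of_nonneg_left (T.le_opNorm _) hL).trans ?_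
    rw [← mul_assoc]
    exact mul_le_mul_of_nonneg_right (le_max_right _ _) (norm_nonneg _)

end UnifLocLip

variable {n m p l : ℕ}

/-- The vector `ẏ` depends on the state through locally Lipschitz maps, uniformly for disturbances
in a ball. -/
theorem unifLocLip_yDot {Θ : Set (Vec p)} {S : System n m p l}
    (hS : S.IsRegular Θ) {k : State n m → ℝ} (hk : ContDiff ℝ ∞ k) (r : ℝ) :
    UnifLocLip {q : Vec p × Vec l | q.1 ∈ Θ ∧ ‖q.1‖ ≤ r ∧ ‖q.2‖ ≤ r}
      fun q w => S.yDot w.1 w.2.1 (k w) q.1 q.2 := by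
  have h1 : (1 : ℕ∞ω) ≤ ∞ := by exact_mod_cast le_top
  refine UnifLocLip.toLp (f := fun (j : Fin m) (q : Vec p × Vec l) (w : State n m) =>
    S.h j (w.1, trunc j w.2.1) + S.g j ((w.1, trunc j w.2.1), q.1) *
      (if hj : (j : ℕ) + 1 < m then w.2.1 ⟨j + 1, hj⟩ else k w)
      + inner ℝ (S.φ j (w.1, trunc j w.2.1)) q.1
      + inner ℝ (S.α j (w.1, trunc j w.2.1)) q.2) fun j => ?_
  refine UnifLocLip.add (UnifLocLip.add (UnifLocLip.add ?_ (UnifLocLip.mul ?_ ?_)) ?_) ?_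
  · exact UnifLocLip.comp_clm (f := fun _ => S.h j)
      (UnifLocLip.of_contDiff ((hS.smooth_h j).of_le h1)) (argL n j)
  · have hg : UnifLocLip {q : Vec p × Vec l | q.1 ∈ Θ ∧ ‖q.1‖ ≤ r ∧ ‖q.2‖ ≤ r}
        fun q ξ => S.g j (ξ, q.1) := by
      intro R
      obtain ⟨L, hL⟩ := hS.locLip_g j (max R r)
      refine ⟨max L 0, le_max_right _ _, fun q hq ξ ξ' hξ hξ' => ?_⟩
      obtain ⟨h2, h3⟩ := hL ξ ξ' q.1 hq.1 (hξ.trans (le_max_left _ _))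
        (hξ'.trans (le_max_left _ _)) (hq.2.1.trans (le_max_right _ _))
      have h4 : L ≤ max L 0 := le_max_left _ _
      exact ⟨h2.trans h4, h3.trans (mul_le_mul_of_nonneg_right h4 (norm_nonneg _))⟩
    exact hg.comp_clm (argL n j)
  · by_cases hj : (j : ℕ) + 1 < m
    · simp only [hj, dite_true]
      exact UnifLocLip.of_contDiff (f := fun w : State n m => w.2.1 ⟨j + 1, hj⟩) (by fun_prop)
    · simp only [hj, dite_false]
      exact UnifLocLip.of_contDiff (hk.of_le h1)
  · exact UnifLocLip.inner (UnifLocLip.comp_clm (f := fun _ => S.φ j)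
      (UnifLocLip.of_contDiff ((hS.smooth_φ j).of_le h1)) (argL n j))
      (UnifLocLip.of_bounded (f := fun q : Vec p × Vec l => q.1) (C := r) fun q hq => hq.2.1)
  · exact UnifLocLip.inner (UnifLocLip.comp_clm (f := fun _ => S.α j)
      (UnifLocLip.of_contDiff ((hS.smooth_α j).of_le h1)) (argL n j))
      (UnifLocLip.of_bounded (f := fun q : Vec p × Vec l => q.2) (C := r) fun q hq => hq.2.2)

theorem unifLocLip_closedLoop [NeZero m] {Θ : Set (Vec p)} {S : System n m p l}
    (hS : S.IsRegular Θ) {k V : State n m → ℝ} (hk : ContDiff ℝ ∞ k) (hV : ContDiff ℝ ∞ V)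
    (Γ ε M r : ℝ) :
    UnifLocLip {q : Vec p × Vec l | q.1 ∈ Θ ∧ ‖q.1‖ ≤ r ∧ ‖q.2‖ ≤ r}
      fun q w => S.closedLoop k V Γ ε M q.1 q.2 w := by
  have h1 : (1 : ℕ∞ω) ≤ ∞ := by exact_mod_cast le_top
  have hx : UnifLocLip {q : Vec p × Vec l | q.1 ∈ Θ ∧ ‖q.1‖ ≤ r ∧ ‖q.2‖ ≤ r}
      fun _ (w : State n m) => System.xDot w.1 w.2.1 :=
    UnifLocLip.of_contDiff (f := fun w : State n m => System.xDot w.1 w.2.1)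
      ((xDotL n m).contDiff.comp
        (by fun_prop : ContDiff ℝ 1 fun w : State n m => (w.1, w.2.1)))
  have hz : UnifLocLip {q : Vec p × Vec l | q.1 ∈ Θ ∧ ‖q.1‖ ≤ r ∧ ‖q.2‖ ≤ r}
      fun _ (w : State n m) => Γ * Real.exp (-w.2.2) * max (V w - ε ^ 2 / (2 * M)) 0 := by
    refine UnifLocLip.mul (f := fun _ w => Γ * Real.exp (-w.2.2)) ?_
      (UnifLocLip.max_zero (f := fun _ w => V w - ε ^ 2 / (2 * M)) ?_)
    · exact UnifLocLip.of_contDiff (f := fun w : State n m => Γ * Real.exp (-w.2.2)) (by fun_prop)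
    · exact UnifLocLip.of_contDiff ((hV.of_le h1).sub contDiff_const)
  exact hx.prodMk ((unifLocLip_yDot hS hk r).prodMk hz)

theorem IsLInf.ae_norm_le {k : ℕ} {A : Set (Vec k)} {d : ℝ → Vec k} (hd : IsLInf A d) :
    ∀ᵐ t ∂(volume.restrict (Ici (0 : ℝ))), ‖d t‖ ≤ supNorm d := by
  have h1 := ae_le_eLpNormEssSup (f := d) (μ := volume.restrict (Ici (0 : ℝ)))
  rw [← eLpNorm_exponent_top] at h1
  have h2 := hd.memLp.2.ne
  filter_upwards [h1] with t ht
  have h3 : (‖d t‖₊ : ENNReal) ≤ ((supNorm d : ℝ≥0) : ENNReal) := by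
    rw [supNorm, ENNReal.coe_toNNReal h2]; exact ht
  exact_mod_cast h3

/-- Composition of a Carathéodory-type map with a measurable function whose values lie in the
(possibly non-measurable) set on which the map is continuous. -/
theorem aestronglyMeasurable_comp_of_continuousOn {X : Type*} [TopologicalSpace X]
    [SecondCountableTopology X] {Y : Type*} [TopologicalSpace Y] [MeasurableSpace Y] [BorelSpace Y]
    [SecondCountableTopology Y] [MeasurableSpace X] [BorelSpace X] {A : Set Y}
    (hA : A.Nonempty) {f : X × Y → ℝ} (hf : ContinuousOn f (univ ×ˢ A)) {μ : Measure ℝ}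
    {u : ℝ → X} (hu : Continuous u) {θ : ℝ → Y} (hθ : AEMeasurable θ μ)
    (hθA : ∀ᵐ t ∂μ, θ t ∈ A) : AEStronglyMeasurable (fun t => f (u t, θ t)) μ := by
  obtain ⟨θ', hm, hr, he⟩ := hθ.exists_ae_eq_range_subset hθA hA
  have hmem : ∀ t, θ' t ∈ A := fun t => hr ⟨t, rfl⟩
  have hc : Continuous fun q : X × A => f (q.1, q.2) := by
    refine hf.comp_continuous (by fun_prop) fun q => ⟨mem_univ _, q.2.2⟩
  have hm' : Measurable fun t => (u t, (⟨θ' t, hmem t⟩ : A)) :=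
    hu.measurable.prodMk (hm.subtype_mk)
  have h1 : AEStronglyMeasurable (fun t => f (u t, θ' t)) μ :=
    (hc.measurable.comp hm').aestronglyMeasurable
  refine h1.congr ?_
  filter_upwards [he] with t ht
  rw [ht]

theorem isCaratheodory_closedLoop [NeZero m] {Θ : Set (Vec p)} (hΘ : Θ.Nonempty)
    {S : System n m p l} (hS : S.IsRegular Θ) {k V : State n m → ℝ} (hk : ContDiff ℝ ∞ k)
    (hV : ContDiff ℝ ∞ V) (Γ ε M : ℝ) {d : ℝ → Vec l} {θ : ℝ → Vec p} (hd : IsLInf univ d)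
    (hθ : IsLInf Θ θ) : IsCaratheodory fun t => S.closedLoop k V Γ ε M (θ t) (d t) where
  lip := by
    intro R
    obtain ⟨L, -, hL⟩ := unifLocLip_closedLoop hS hk hV Γ ε M
      (max (supNorm θ : ℝ) (supNorm d : ℝ)) R
    refine ⟨L, ?_⟩
    filter_upwards [hd.ae_norm_le, hθ.ae_norm_le, ae_restrict_mem measurableSet_Ici]
      with t h1 h2 h3 v v' hv hv'
    exact hL (θ t, d t) ⟨hθ.mem t h3, h2.trans (le_max_left _ _), h1.trans (le_max_right _ _)⟩
      v v' hv hv'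
  meas := by
    intro v hv
    have hx : Continuous fun s => (v s).1 := by fun_prop
    have harg : ∀ j : Fin m, Continuous fun s => ((v s).1, trunc j (v s).2.1) := fun j =>
      (argL n j).continuous.comp hv
    have hθm := hθ.memLp.1
    have hdm := hd.memLp.1
    have hθΘ : ∀ᵐ t ∂(volume.restrict (Ici (0 : ℝ))), θ t ∈ Θ := by
      filter_upwards [ae_restrict_mem measurableSet_Ici] with t ht using hθ.mem t ht
    refine AEStronglyMeasurable.prodMk ?_ (AEStronglyMeasurable.prodMk ?_ ?_)
    · exact ((xDotL n m).continuous.comp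
        (by fun_prop : Continuous fun s => ((v s).1, (v s).2.1))).aestronglyMeasurable
    · refine (PiLp.continuous_toLp 2 _).comp_aestronglyMeasurable
        (aemeasurable_pi_iff.2 fun j =>
          AEStronglyMeasurable.aemeasurable ?_).aestronglyMeasurable
      refine AEStronglyMeasurable.add (AEStronglyMeasurable.add (AEStronglyMeasurable.add ?_
        (AEStronglyMeasurable.mul ?_ ?_)) ?_) ?_
      · exact ((hS.smooth_h j).continuous.comp (harg j)).aestronglyMeasurable
      · exact aestronglyMeasurable_comp_of_continuousOn hΘ (hS.smooth_g j).continuousOn (harg j)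
          hθm.aemeasurable hθΘ
      · by_cases hj : (j : ℕ) + 1 < m
        · simp only [hj, dite_true]
          exact Continuous.aestronglyMeasurable (by fun_prop)
        · simp only [hj, dite_false]
          exact (hk.continuous.comp hv).aestronglyMeasurable
      · exact ((hS.smooth_φ j).continuous.comp (harg j)).aestronglyMeasurable.inner hθm
      · exact ((hS.smooth_α j).continuous.comp (harg j)).aestronglyMeasurable.inner hdm
    · have := hV.continuous
      exact Continuous.aestronglyMeasurable (by fun_prop)

/-! ### Differential inequalities along Carathéodory solutions -/

theorem IsSolutionOn.init {F : ℝ → State n m → State n m} {w₀ : State n m} {T : ℝ}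
    {w : ℝ → State n m} (h : IsSolutionOn F w₀ T w) (hT : 0 ≤ T) : w 0 = w₀ := by
  simpa using h.eq 0 ⟨le_rfl, hT⟩

theorem IsSolutionOn.sub_eq_integral {F : ℝ → State n m → State n m} {w₀ : State n m} {T : ℝ}
    {w : ℝ → State n m} (h : IsSolutionOn F w₀ T w) {s t : ℝ} (hs : 0 ≤ s) (hst : s ≤ t)
    (ht : t ≤ T) : IntervalIntegrable (fun r => F r (w r)) volume s t ∧
      w t - w s = ∫ r in s..t, F r (w r) := by
  have h1 := (h.mono hs (hst.trans ht)).integrable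
  have h2 := (h.mono (hs.trans hst) ht).integrable
  refine ⟨h1.symm.trans h2, ?_⟩
  rw [h.eq t ⟨hs.trans hst, ht⟩, h.eq s ⟨hs, hst.trans ht⟩, add_sub_add_left_eq_sub,
    intervalIntegral.integral_interval_sub_left h2 h1]

theorem IsSolutionOn.ae_hasDerivAt {F : ℝ → State n m → State n m} {w₀ : State n m} {T : ℝ}
    {w : ℝ → State n m} (h : IsSolutionOn F w₀ T w) :
    ∀ᵐ r, r ∈ Icc 0 T → HasDerivAt w (F r (w r)) r := by
  by_cases hT : 0 ≤ T
  swap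
  · refine ae_of_all _ fun r hr => absurd (hr.1.trans hr.2) hT
  have hne : ∀ u : ℝ, ∀ᵐ r : ℝ, r ≠ u := fun u => by simp [ae_iff, measure_singleton]
  filter_upwards [h.integrable.ae_hasDerivAt_integral, hne 0, hne T] with r hr h0 h1 hr'
  rw [uIcc_of_le hT] at hr
  have h2 := (hr hr' 0 ⟨le_rfl, hT⟩).const_add w₀
  refine h2.congr_of_eventuallyEq ?_
  filter_upwards [Icc_mem_nhds (lt_of_le_of_ne hr'.1 (Ne.symm h0)) (lt_of_le_of_ne hr'.2 h1)]
    with u hu using h.eq u hu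

/-- Exponential decay of `V` along a Carathéodory solution: the differential inequality
`V̇ ≤ -c V + K` for almost every time. -/
theorem IsSolutionOn.le_exp_decay {F : ℝ → State n m → State n m} (hF : IsCaratheodory F)
    {w₀ : State n m} {T : ℝ} {w : ℝ → State n m} (h : IsSolutionOn F w₀ T w)
    {V : State n m → ℝ} (hV : ContDiff ℝ 1 V) {c K : ℝ} (hc : 0 < c) {s t : ℝ} (hs : 0 ≤ s)
    (hst : s ≤ t) (ht : t ≤ T)
    (hineq : ∀ᵐ r, r ∈ Icc s t → fderiv ℝ V (w r) (F r (w r)) ≤ -c * V (w r) + K) :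
    V (w t) ≤ Real.exp (-c * (t - s)) * V (w s) + K / c * (1 - Real.exp (-c * (t - s))) := by
  have hsub : Icc s t ⊆ Icc 0 T := Icc_subset_Icc hs ht
  obtain ⟨R, hR⟩ := h.exists_bound
  obtain ⟨L, hL⟩ := hF.lip R
  -- `V ∘ w` is Lipschitz, hence absolutely continuous
  have hwL : LipschitzOnWith (Real.toNNReal L) w (Icc s t) := by
    have key : ∀ u ∈ Icc s t, ∀ v ∈ Icc s t, u ≤ v → ‖w v - w u‖ ≤ L * (v - u) := by
      intro u hu v hv huv
      have hu' := hsub hu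
      have hv' := hsub hv
      obtain ⟨-, e⟩ := h.sub_eq_integral hu'.1 huv hv'.2
      have h1 := intervalIntegral.norm_integral_le_of_norm_le_const_ae
        (a := u) (b := v) (C := L) (f := fun r => F r (w r)) (by
          filter_upwards [ae_restrict_uIoc hL hu'.1 hv'.1] with r hr hr'
          have h2 := hr hr'
          rw [uIoc_of_le huv] at hr'
          have h3 := hR r ⟨hu'.1.trans hr'.1.le, hr'.2.trans hv'.2⟩
          exact (h2 _ _ h3 h3).1)
      rw [abs_of_nonneg (sub_nonneg.2 huv)] at h1
      rw [e]; exact h1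
    refine LipschitzOnWith.of_dist_le_mul fun u hu v hv => ?_
    rw [dist_eq_norm, Real.dist_eq]
    rcases le_total u v with huv | huv
    · rw [norm_sub_rev, abs_sub_comm, abs_of_nonneg (sub_nonneg.2 huv)]
      exact (key u hu v hv huv).trans
        (mul_le_mul_of_nonneg_right (Real.le_coe_toNNReal L) (sub_nonneg.2 huv))
    · rw [abs_of_nonneg (sub_nonneg.2 huv)]
      exact (key v hv u hu huv).trans
        (mul_le_mul_of_nonneg_right (Real.le_coe_toNNReal L) (sub_nonneg.2 huv))
  obtain ⟨KV, hKV⟩ := hV.contDiffOn.exists_lipschitzOnWith one_ne_zero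
    (convex_closedBall (0 : State n m) R) (isCompact_closedBall 0 R)
  have hmaps : MapsTo w (Icc s t) (Metric.closedBall (0 : State n m) R) := fun r hr => by
    simpa using hR r (hsub hr)
  have hVw : AbsolutelyContinuousOnInterval (fun r => V (w r)) s t := by
    refine LipschitzOnWith.absolutelyContinuousOnInterval (K := KV * Real.toNNReal L) ?_
    rw [uIcc_of_le hst]
    exact hKV.comp hwL hmaps
  have hexp : AbsolutelyContinuousOnInterval (fun r => Real.exp (c * r)) s t :=
    ContDiffOn.absolutelyContinuousOnInterval
      (by fun_prop : ContDiff ℝ 1 fun r => Real.exp (c * r)).contDiffOn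
  have hcst : AbsolutelyContinuousOnInterval (fun _ : ℝ => K / c) s t :=
    ContDiffOn.absolutelyContinuousOnInterval contDiff_const.contDiffOn
  have hψ : AbsolutelyContinuousOnInterval (fun r => Real.exp (c * r) * (K / c - V (w r))) s t :=
    hexp.fun_mul (hcst.fun_sub hVw)
  have hint := hψ.integral_deriv_eq_sub
  have hpos : 0 ≤ ∫ r in s..t, deriv (fun r => Real.exp (c * r) * (K / c - V (w r))) r := by
    refine intervalIntegral.integral_nonneg_of_ae_restrict hst ?_
    rw [EventuallyLE, ae_restrict_iff' measurableSet_Icc]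
    filter_upwards [hineq, h.ae_hasDerivAt] with r h1 h2 hr
    have h3 := h1 hr
    have h4 : HasDerivAt (fun r => V (w r)) (fderiv ℝ V (w r) (F r (w r))) r :=
      ((hV.differentiable one_ne_zero).differentiableAt.hasFDerivAt).comp_hasDerivAt r
        (h2 (hsub hr))
    have h5 : HasDerivAt (fun r => Real.exp (c * r)) (Real.exp (c * r) * c) r := by
      have h6 : HasDerivAt (fun r : ℝ => c * r) c r := by
        simpa using (hasDerivAt_id r).const_mul c
      exact h6.exp
    have h7 := (h5.mul (h4.const_sub (K / c))).deriv
    change 0 ≤ deriv (fun r => Real.exp (c * r) * (K / c - V (w r))) r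
    have h8 : deriv (fun r => Real.exp (c * r) * (K / c - V (w r))) r
        = Real.exp (c * r) * (K - c * V (w r) - fderiv ℝ V (w r) (F r (w r))) := by
      refine Eq.trans h7 ?_
      field_simp
      ring
    rw [h8]
    exact mul_nonneg (Real.exp_pos _).le (by linarith)
  rw [hint] at hpos
  have e1 : Real.exp (-c * (t - s)) = Real.exp (c * s) / Real.exp (c * t) := by
    rw [← Real.exp_sub]; congr 1; ring
  have h9 : Real.exp (c * s) / Real.exp (c * t) * (K / c - V (w s)) ≤ K / c - V (w t) := by
    rw [div_mul_eq_mul_div, div_le_iff₀ (Real.exp_pos _)]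
    linarith
  rw [e1]
  linarith

/-! ### Closed loops with a dissipation inequality -/

/-- The gain `(a / M) (D² + ((Q - b - λ(e^ζ))⁺)²) / (1 + κ(e^ζ))` with which disturbances of size
`D` and parameters of size `Q` enter the dissipation inequality when `z = ζ`. -/
noncomputable def gain (b a M : ℝ) (κ lam : ℝ → ℝ) (D Q ζ : ℝ) : ℝ :=
  a / M * ((D ^ 2 + max (Q - b - lam (Real.exp ζ)) 0 ^ 2) / (1 + κ (Real.exp ζ)))

/-- A feedback `k` and a function `V` that is a Lyapunov function for the closed loop, with the
decay rate `c` and the disturbance gain `gain b a M κ lam`. -/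
structure IsLyapunovPair [NeZero m] (S : System n m p l) (Θ : Set (Vec p)) (b Γ ε c a : ℝ)
    (κ lam : ℝ → ℝ) (k V : State n m → ℝ) (M : ℝ) : Prop where
  contDiff_k : ContDiff ℝ ∞ k
  contDiff_V : ContDiff ℝ ∞ V
  k_zero : ∀ z : ℝ, k (0, 0, z) = 0
  V_zero : ∀ z : ℝ, V (0, 0, z) = 0
  V_pos : ∀ (x : Vec n) (y : Vec m) (z : ℝ), (x, y) ≠ 0 → 0 < V (x, y, z)
  one_le : 1 ≤ M
  coercive : ∀ w : State n m, ‖w.1‖ ^ 2 + |w.2.1 0| ^ 2 ≤ M * V w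
  proper : ∀ R : ℝ, ∃ C : ℝ, ∀ w : State n m, |w.2.2| ≤ R → V w ≤ R → ‖w‖ ≤ C
  dissip : ∀ (w : State n m), ∀ θ ∈ Θ, ∀ d : Vec l,
    fderiv ℝ V w (S.closedLoop k V Γ ε M θ d w) ≤ -c * V w + gain b a M κ lam ‖d‖ ‖θ‖ w.2.2

namespace IsSmoothKInf

variable {κ : ℝ → ℝ}

theorem nonneg_exp (hκ : IsSmoothKInf κ) (z : ℝ) : 0 ≤ κ (Real.exp z) := by
  have := hκ.strictMono.monotoneOn (mem_Ici.2 le_rfl) (mem_Ici.2 (Real.exp_pos z).le)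
    (Real.exp_pos z).le
  rwa [hκ.zero] at this

theorem monotone_exp (hκ : IsSmoothKInf κ) : Monotone fun z => κ (Real.exp z) :=
  fun _ _ h => hκ.strictMono.monotoneOn (mem_Ici.2 (Real.exp_pos _).le)
    (mem_Ici.2 (Real.exp_pos _).le) (Real.exp_le_exp.2 h)

theorem continuous_exp (hκ : IsSmoothKInf κ) : Continuous fun z => κ (Real.exp z) :=
  hκ.smooth.continuousOn.comp_continuous Real.continuous_exp fun z => (Real.exp_pos z).le

theorem tendsto_exp (hκ : IsSmoothKInf κ) : Tendsto (fun z => κ (Real.exp z)) atTop atTop :=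
  hκ.tendsto.comp Real.tendsto_exp_atTop

end IsSmoothKInf

section gain

variable {b a M : ℝ} {κ lam : ℝ → ℝ}

theorem gain_nonneg (ha : 0 ≤ a) (hM : 0 ≤ M) (hκ : IsSmoothKInf κ) (D Q ζ : ℝ) :
    0 ≤ gain b a M κ lam D Q ζ := by
  have := hκ.nonneg_exp ζ
  unfold gain
  positivity

theorem gain_mono (ha : 0 ≤ a) (hM : 0 ≤ M) (hκ : IsSmoothKInf κ) (hlam : IsSmoothKInf lam)
    {D D' Q Q' ζ ζ' : ℝ} (hD : 0 ≤ D) (hDD : D ≤ D') (hQ : Q ≤ Q') (hζ : ζ' ≤ ζ) :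
    gain b a M κ lam D Q ζ ≤ gain b a M κ lam D' Q' ζ' := by
  have h1 := hκ.nonneg_exp ζ'
  have h2 := hκ.monotone_exp hζ
  have h3 := hlam.monotone_exp hζ
  simp only at h2 h3
  have h4 : max (Q - b - lam (Real.exp ζ)) 0 ≤ max (Q' - b - lam (Real.exp ζ')) 0 :=
    max_le_max (by linarith) le_rfl
  have h5 : 0 ≤ max (Q - b - lam (Real.exp ζ)) 0 := le_max_right _ _
  unfold gain
  gcongr

theorem exists_gain_le (hκ : IsSmoothKInf κ) (hlam : IsSmoothKInf lam) (D Q : ℝ)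
    {η : ℝ} (hη : 0 < η) : ∃ Z, gain b a M κ lam D Q Z ≤ η := by
  have h1 : ∀ᶠ ζ in atTop, Q - b ≤ lam (Real.exp ζ) := hlam.tendsto_exp.eventually_ge_atTop _
  have h2 : Tendsto (fun ζ => a / M * (D ^ 2 / (1 + κ (Real.exp ζ)))) atTop (𝓝 (a / M * 0)) :=
    ((tendsto_const_nhds).div_atTop (tendsto_atTop_add_const_left _ 1 hκ.tendsto_exp)).const_mul _
  rw [mul_zero] at h2
  obtain ⟨Z, hZ1, hZ2⟩ := (h1.and (h2.eventually_le_const hη)).exists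
  refine ⟨Z, ?_⟩
  unfold gain
  rw [max_eq_right (by linarith)]
  simpa using hZ2

end gain

section closedLoop

variable [NeZero m] {S : System n m p l} {Θ : Set (Vec p)} {b Γ ε c a : ℝ} {κ lam : ℝ → ℝ}
  {k V : State n m → ℝ} {M : ℝ} {d : ℝ → Vec l} {θ : ℝ → Vec p} {w₀ : State n m} {T : ℝ}
  {w : ℝ → State n m}

theorem IsLyapunovPair.V_nonneg (hP : IsLyapunovPair S Θ b Γ ε c a κ lam k V M) (w : State n m) :
    0 ≤ V w := by
  have h1 := hP.coercive w
  have h2 : 0 ≤ M * V w := le_trans (by positivity) h1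
  exact nonneg_of_mul_nonneg_right h2 (by linarith [hP.one_le])

theorem IsSolutionOn.z_sub (hV : Continuous V)
    (h : IsSolutionOn (fun t => S.closedLoop k V Γ ε M (θ t) (d t)) w₀ T w) {s t : ℝ} (hs : 0 ≤ s)
    (hst : s ≤ t) (ht : t ≤ T) :
    IntervalIntegrable (fun r => Γ * Real.exp (-(w r).2.2) * max (V (w r) - ε ^ 2 / (2 * M)) 0)
      volume s t ∧ (w t).2.2 - (w s).2.2
        = ∫ r in s..t, Γ * Real.exp (-(w r).2.2) * max (V (w r) - ε ^ 2 / (2 * M)) 0 := by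
  obtain ⟨h1, h2⟩ := h.sub_eq_integral hs hst ht
  constructor
  · refine ContinuousOn.intervalIntegrable_of_Icc hst ?_
    have hw := h.continuousOn.mono (Icc_subset_Icc hs ht)
    have hVw : ContinuousOn (fun r => V (w r)) (Icc s t) := hV.comp_continuousOn hw
    fun_prop
  · have h3 := ((ContinuousLinearMap.snd ℝ (Vec m) ℝ).comp
      (ContinuousLinearMap.snd ℝ (Vec n) (Vec m × ℝ))).intervalIntegral_comp_comm h1
    rw [← h2] at h3
    exact h3.symm

theorem IsSolutionOn.z_mono (hΓ : 0 < Γ) (hV : Continuous V)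
    (h : IsSolutionOn (fun t => S.closedLoop k V Γ ε M (θ t) (d t)) w₀ T w) {s t : ℝ} (hs : 0 ≤ s)
    (hst : s ≤ t) (ht : t ≤ T) : (w s).2.2 ≤ (w t).2.2 := by
  rw [← sub_nonneg, (h.z_sub hV hs hst ht).2]
  refine intervalIntegral.integral_nonneg hst fun r _ => ?_
  exact mul_nonneg (mul_nonneg hΓ.le (Real.exp_pos _).le) (le_max_right _ _)

/-- Decay of `V` along the closed loop between the times `s` and `t`, the gain being evaluated at a
lower bound `ζ` of `z`. -/
theorem IsLyapunovPair.decay (hP : IsLyapunovPair S Θ b Γ ε c a κ lam k V M) (hΘ : Θ.Nonempty)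
    (hS : S.IsRegular Θ) (hΓ : 0 < Γ) (hc : 0 < c) (ha : 0 < a) (hκ : IsSmoothKInf κ)
    (hlam : IsSmoothKInf lam) (hd : IsLInf univ d) (hθ : IsLInf Θ θ)
    (h : IsSolutionOn (fun t => S.closedLoop k V Γ ε M (θ t) (d t)) w₀ T w) {s t D Q ζ : ℝ}
    (hs : 0 ≤ s) (hst : s ≤ t) (ht : t ≤ T)
    (hD : ∀ᵐ r ∂(volume.restrict (Ici s)), ‖d r‖ ≤ D)
    (hQ : ∀ᵐ r ∂(volume.restrict (Ici s)), ‖θ r‖ ≤ Q) (hζ : ζ ≤ (w s).2.2) :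
    V (w t) ≤ Real.exp (-c * (t - s)) * V (w s)
      + gain b a M κ lam D Q ζ / c * (1 - Real.exp (-c * (t - s))) := by
  refine h.le_exp_decay (isCaratheodory_closedLoop hΘ hS hP.contDiff_k hP.contDiff_V Γ ε M hd hθ)
    (hP.contDiff_V.of_le (by exact_mod_cast le_top)) hc hs hst ht ?_
  rw [ae_restrict_iff' measurableSet_Ici] at hD hQ
  filter_upwards [hD, hQ] with r h1 h2 hr
  refine (hP.dissip (w r) (θ r) (hθ.mem r (hs.trans hr.1)) (d r)).trans ?_
  have h3 := h.z_mono hΓ hP.contDiff_V.continuous hs hr.1 (hr.2.trans ht)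
  have h4 := gain_mono (b := b) ha.le (zero_le_one.trans hP.one_le) hκ hlam (norm_nonneg (d r))
    (h1 hr.1) (h2 hr.1) (hζ.trans h3)
  linarith

theorem exp_neg_mul_mem_Icc {c t : ℝ} (hc : 0 < c) (ht : 0 ≤ t) :
    Real.exp (-c * t) ∈ Icc (0 : ℝ) 1 := by
  refine ⟨(Real.exp_pos _).le, Real.exp_le_one_iff.2 ?_⟩
  nlinarith [mul_nonneg hc.le ht]

/-- A priori bounds: once `z` is so large that the gain is at most `c ε² / (2 M)`, the excess of `V`
over the deadzone decays exponentially, so that `z` increases only by a controlled amount. -/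
theorem IsLyapunovPair.exists_bound (hP : IsLyapunovPair S Θ b Γ ε c a κ lam k V M)
    (hΘ : Θ.Nonempty) (hS : S.IsRegular Θ) (hΓ : 0 < Γ) (hε : 0 < ε) (hc : 0 < c) (ha : 0 < a)
    (hκ : IsSmoothKInf κ) (hlam : IsSmoothKInf lam) (R : ℝ) :
    ∃ C : ℝ, ∀ (w₀ : State n m) (d : ℝ → Vec l) (θ : ℝ → Vec p), IsLInf univ d → IsLInf Θ θ →
      ‖w₀‖ ≤ R → (supNorm d : ℝ) ≤ R → (supNorm θ : ℝ) ≤ R → ∀ T : ℝ, 0 < T → ∀ w,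
      IsSolutionOn (fun t => S.closedLoop k V Γ ε M (θ t) (d t)) w₀ T w →
      ∀ t ∈ Icc 0 T, ‖w t‖ ≤ C := by
  have hM : 0 < M := zero_lt_one.trans_le hP.one_le
  have hVc := hP.contDiff_V.continuous
  set e₀ := ε ^ 2 / (2 * M) with he₀
  have he₀pos : 0 < e₀ := by positivity
  obtain ⟨V₀, hV₀⟩ := (isCompact_closedBall (0 : State n m) R).exists_bound_of_continuousOn
    hVc.continuousOn
  set g := gain b a M κ lam with hg
  have hg0 : ∀ D Q ζ, 0 ≤ g D Q ζ := gain_nonneg ha.le hM.le hκ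
  set V₁ := max V₀ 0 + g R R (-R) / c with hV₁
  have hV₁0 : 0 ≤ V₁ := add_nonneg (le_max_right _ _) (div_nonneg (hg0 _ _ _) hc.le)
  obtain ⟨Z, hZ⟩ := exists_gain_le (b := b) (a := a) (M := M) hκ hlam R R (mul_pos hc he₀pos)
  set ζ₁ := max (max R Z + Γ * Real.exp R * V₁ / c) V₁ with hζ₁
  obtain ⟨C, hC⟩ := hP.proper (max ζ₁ R)
  refine ⟨C, fun w₀ d θ hd hθ hw₀ hdR hθR T hT w h t ht => ?_⟩
  have hD := hd.ae_norm_le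
  have hQ := hθ.ae_norm_le
  have hDs : ∀ s : ℝ, 0 ≤ s → ∀ᵐ r ∂(volume.restrict (Ici s)), ‖d r‖ ≤ R := fun s hs => by
    filter_upwards [ae_restrict_of_ae_restrict_of_subset (Ici_subset_Ici.2 hs) hD] with r hr
      using hr.trans hdR
  have hQs : ∀ s : ℝ, 0 ≤ s → ∀ᵐ r ∂(volume.restrict (Ici s)), ‖θ r‖ ≤ R := fun s hs => by
    filter_upwards [ae_restrict_of_ae_restrict_of_subset (Ici_subset_Ici.2 hs) hQ] with r hr
      using hr.trans hθR
  have h0 : w 0 = w₀ := h.init hT.le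
  have hz₀ : |w₀.2.2| ≤ R := le_trans (le_trans (norm_snd_le w₀.2) (norm_snd_le w₀)) hw₀
  have hVle : ∀ s ∈ Icc 0 T, V (w s) ≤ V₁ := by
    intro s hs
    have h1 := hP.decay hΘ hS hΓ hc ha hκ hlam hd hθ h (s := 0) (ζ := -R) le_rfl hs.1 hs.2
      (hDs 0 le_rfl) (hQs 0 le_rfl) (by rw [h0]; exact (abs_le.1 hz₀).1)
    rw [h0, sub_zero] at h1
    obtain ⟨h2, h3⟩ := exp_neg_mul_mem_Icc hc hs.1
    have h4 : V w₀ ≤ max V₀ 0 :=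
      ((le_abs_self _).trans (hV₀ w₀ (by simpa using hw₀))).trans (le_max_left _ _)
    have h5 := hP.V_nonneg w₀
    have h6 : 0 ≤ g R R (-R) / c := div_nonneg (hg0 _ _ _) hc.le
    have h7 := mul_le_mul_of_nonneg_right h3 h5
    have h8 := mul_nonneg h6 h2
    rw [hV₁]
    nlinarith
  have hz : (w t).2.2 ≤ max R Z + Γ * Real.exp R * V₁ / c := by
    have hnn : 0 ≤ Γ * Real.exp R * V₁ / c := by positivity
    by_cases hzt : (w t).2.2 ≤ max w₀.2.2 Z
    · have : max w₀.2.2 Z ≤ max R Z := max_le_max (abs_le.1 hz₀).2 le_rfl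
      linarith
    -- the time at which `z` crosses the threshold
    have hcont : ContinuousOn (fun r => (w r).2.2) (Icc 0 t) :=
      (h.continuousOn.mono (Icc_subset_Icc_right ht.2)).snd.snd
    obtain ⟨τ, hτ, hzτ⟩ := intermediate_value_Icc ht.1 hcont
      (show max w₀.2.2 Z ∈ Icc (w 0).2.2 (w t).2.2 by
        rw [h0]; exact ⟨le_max_left _ _, (not_le.1 hzt).le⟩)
    simp only at hzτ
    obtain ⟨hi, hsub⟩ := h.z_sub hVc hτ.1 hτ.2 ht.2
    have hle : ∫ r in τ..t, Γ * Real.exp (-(w r).2.2) * max (V (w r) - ε ^ 2 / (2 * M)) 0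
        ≤ ∫ r in τ..t, Γ * Real.exp R * V₁ * Real.exp (-c * (r - τ)) := by
      refine intervalIntegral.integral_mono_on hτ.2 hi
        (Continuous.intervalIntegrable (by fun_prop) _ _) fun r hr => ?_
      have hrT : r ≤ T := hr.2.trans ht.2
      have h1 := hP.decay hΘ hS hΓ hc ha hκ hlam hd hθ h (s := τ) (ζ := Z) hτ.1 hr.1 hrT
        (hDs τ hτ.1) (hQs τ hτ.1) (by rw [hzτ]; exact le_max_right _ _)
      obtain ⟨h2, h3⟩ := exp_neg_mul_mem_Icc hc (sub_nonneg.2 hr.1)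
      have h4 : max (V (w r) - ε ^ 2 / (2 * M)) 0 ≤ V₁ * Real.exp (-c * (r - τ)) := by
        refine max_le ?_ (by positivity)
        have h5 : g R R Z / c ≤ e₀ := by rw [div_le_iff₀ hc]; linarith
        have h6 := hVle τ ⟨hτ.1, hτ.2.trans ht.2⟩
        have h7 := mul_le_mul_of_nonneg_left h6 h2
        have h8 := mul_le_mul_of_nonneg_right h5 (sub_nonneg.2 h3)
        have h9 := mul_nonneg he₀pos.le h2
        nlinarith
      have h5 : Real.exp (-(w r).2.2) ≤ Real.exp R := by
        rw [Real.exp_le_exp]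
        have := h.z_mono hΓ hVc le_rfl (hτ.1.trans hr.1) hrT
        rw [h0] at this
        have := (abs_le.1 hz₀).1
        linarith
      calc Γ * Real.exp (-(w r).2.2) * max (V (w r) - ε ^ 2 / (2 * M)) 0
          ≤ Γ * Real.exp R * (V₁ * Real.exp (-c * (r - τ))) := by gcongr
        _ = _ := by ring
    have hint : ∫ r in τ..t, Γ * Real.exp R * V₁ * Real.exp (-c * (r - τ))
        = Γ * Real.exp R * V₁ / c * (1 - Real.exp (-c * (t - τ))) := by
      have hder : ∀ r ∈ uIcc τ t, HasDerivAt
          (fun r => -(Γ * Real.exp R * V₁ / c) * Real.exp (-c * (r - τ)))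
          (Γ * Real.exp R * V₁ * Real.exp (-c * (r - τ))) r := by
        intro r _
        have h1 : HasDerivAt (fun r : ℝ => -c * (r - τ)) (-c) r := by
          simpa using ((hasDerivAt_id r).sub_const τ).const_mul (-c)
        refine (h1.exp.const_mul (-(Γ * Real.exp R * V₁ / c))).congr_deriv ?_
        field_simp
      rw [intervalIntegral.integral_eq_sub_of_hasDerivAt hder
        (Continuous.intervalIntegrable (by fun_prop) _ _), sub_self, mul_zero, Real.exp_zero]
      ring
    have h2 := mul_nonneg hnn (exp_neg_mul_mem_Icc hc (sub_nonneg.2 hτ.2)).1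
    have h3 : max w₀.2.2 Z ≤ max R Z := max_le_max (abs_le.1 hz₀).2 le_rfl
    have h4 : (w t).2.2 - max w₀.2.2 Z ≤ Γ * Real.exp R * V₁ / c := by
      rw [← hzτ, hsub]
      refine hle.trans ?_
      rw [hint]
      linarith
    linarith
  refine hC (w t) (abs_le.2 ⟨?_, ?_⟩) ?_
  · have h1 := h.z_mono hΓ hVc le_rfl ht.1 ht.2
    rw [h0] at h1
    have h2 := (abs_le.1 hz₀).1
    have h3 : R ≤ max ζ₁ R := le_max_right _ _
    linarith
  · exact hz.trans ((le_max_left _ _).trans (le_max_left _ _))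
  · exact (hVle t ht).trans ((le_max_right _ _).trans (le_max_left _ _))

end closedLoop

/-! ### Asymptotics of the closed loop -/

theorem eventually_essAtTop_iff {P : ℝ → Prop} :
    (∀ᶠ t in essAtTop, P t) ↔ ∃ T, 0 ≤ T ∧ ∀ᵐ t ∂(volume.restrict (Ici T)), P t := by
  constructor
  · intro h
    obtain ⟨s, hs, s', hs', e⟩ := mem_inf_iff.1 h
    obtain ⟨T, hT⟩ := mem_atTop_sets.1 hs
    refine ⟨max T 0, le_max_right _ _, ?_⟩
    rw [ae_restrict_iff' measurableSet_Ici]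
    filter_upwards [hs'] with t ht ht'
    have : t ∈ s ∩ s' := ⟨hT t ((le_max_left _ _).trans ht'), ht⟩
    rw [← e] at this
    exact this
  · rintro ⟨T, -, hT⟩
    rw [ae_restrict_iff' measurableSet_Ici] at hT
    exact mem_inf_of_inter (mem_atTop T) hT fun t ht => ht.2 ht.1

section closedLoop

variable [NeZero m] {S : System n m p l} {Θ : Set (Vec p)} {b Γ ε c a : ℝ} {κ lam : ℝ → ℝ}
  {k V : State n m → ℝ} {M : ℝ} {d : ℝ → Vec l} {θ : ℝ → Vec p} {w₀ : State n m}
  {w : ℝ → State n m}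

/-- `V` ultimately enters every neighbourhood of the deadzone. This is a one-sided form of
Barbalat's argument: `V` increases at most linearly, so every time at which it exceeds the deadzone
by `η` forces a fixed increment of `z`, which converges. -/
theorem IsLyapunovPair.eventually_le (hP : IsLyapunovPair S Θ b Γ ε c a κ lam k V M)
    (hΘ : Θ.Nonempty) (hS : S.IsRegular Θ) (hΓ : 0 < Γ) (hc : 0 < c) (ha : 0 < a)
    (hκ : IsSmoothKInf κ) (hlam : IsSmoothKInf lam) (hd : IsLInf univ d) (hθ : IsLInf Θ θ)
    (h : ∀ T : ℝ, 0 < T →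
      IsSolutionOn (fun t => S.closedLoop k V Γ ε M (θ t) (d t)) w₀ T w) {zInf : ℝ}
    (hz : Tendsto (fun t => (w t).2.2) atTop (𝓝 zInf)) (hzle : ∀ t, 0 ≤ t → (w t).2.2 ≤ zInf)
    {η : ℝ} (hη : 0 < η) : ∀ᶠ t in atTop, V (w t) ≤ ε ^ 2 / (2 * M) + η := by
  have hVc := hP.contDiff_V.continuous
  have hM : 0 < M := zero_lt_one.trans_le hP.one_le
  set e₀ := ε ^ 2 / (2 * M) with he₀
  have h0 : w 0 = w₀ := (h 1 one_pos).init zero_le_one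
  set K := gain b a M κ lam (supNorm d) (supNorm θ) w₀.2.2 with hK
  have hK0 : 0 ≤ K := gain_nonneg ha.le hM.le hκ _ _ _
  have hgrow : ∀ s t, 0 ≤ s → s ≤ t → V (w t) ≤ V (w s) + K * (t - s) := by
    intro s t hs hst
    have hT : 0 < t + 1 := by linarith
    have h1 := hP.decay hΘ hS hΓ hc ha hκ hlam hd hθ (h (t + 1) hT) hs hst (by linarith)
      (ae_restrict_of_ae_restrict_of_subset (Ici_subset_Ici.2 hs) hd.ae_norm_le)
      (ae_restrict_of_ae_restrict_of_subset (Ici_subset_Ici.2 hs) hθ.ae_norm_le)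
      (ζ := w₀.2.2) (by
        have := (h (t + 1) hT).z_mono hΓ hVc le_rfl hs (by linarith)
        rwa [h0] at this)
    obtain ⟨h2, h3⟩ := exp_neg_mul_mem_Icc hc (sub_nonneg.2 hst)
    have h4 : 1 - Real.exp (-c * (t - s)) ≤ c * (t - s) := by
      have := Real.add_one_le_exp (-c * (t - s))
      linarith
    have h5 : K / c * (1 - Real.exp (-c * (t - s))) ≤ K / c * (c * (t - s)) :=
      mul_le_mul_of_nonneg_left h4 (div_nonneg hK0 hc.le)
    have h6 : K / c * (c * (t - s)) = K * (t - s) := by field_simp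
    have h7 := mul_le_mul_of_nonneg_right h3 (hP.V_nonneg (w s))
    linarith
  set τ := η / (2 * (K + 1)) with hτ
  have hτ0 : 0 < τ := by positivity
  set δ := τ * (Γ * Real.exp (-zInf) * (η / 2)) with hδ
  have hδ0 : 0 < δ := by positivity
  have hinc : Tendsto (fun t => (w t).2.2 - (w (t - τ)).2.2) atTop (𝓝 0) := by
    have h1 : Tendsto (fun t : ℝ => t - τ) atTop atTop :=
      tendsto_atTop_add_const_right _ (-τ) tendsto_id
    have := hz.sub (hz.comp h1)
    rwa [sub_self] at this
  filter_upwards [hinc.eventually_lt_const hδ0, eventually_ge_atTop τ, eventually_gt_atTop 0]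
    with t ht1 ht2 ht3
  by_contra! hcon
  obtain ⟨hi, he⟩ := (h t ht3).z_sub hVc (s := t - τ) (by linarith) (by linarith) le_rfl
  have hlow : ∫ r in (t - τ)..t, Γ * Real.exp (-zInf) * (η / 2)
      ≤ ∫ r in (t - τ)..t, Γ * Real.exp (-(w r).2.2) * max (V (w r) - ε ^ 2 / (2 * M)) 0 := by
    refine intervalIntegral.integral_mono_on (by linarith) intervalIntegrable_const hi
      fun r hr => ?_
    have hr0 : 0 ≤ r := by linarith [hr.1]
    have h1 : η / 2 ≤ max (V (w r) - ε ^ 2 / (2 * M)) 0 := by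
      refine le_max_of_le_left ?_
      have h2 := hgrow r t hr0 hr.2
      have h3 : K * (t - r) ≤ K * τ := mul_le_mul_of_nonneg_left (by linarith [hr.1]) hK0
      have h4 : (K + 1) * τ = η / 2 := by rw [hτ]; field_simp
      linarith
    have h5 : Real.exp (-zInf) ≤ Real.exp (-(w r).2.2) :=
      Real.exp_le_exp.2 (neg_le_neg (hzle r hr0))
    gcongr
  rw [intervalIntegral.integral_const, sub_sub_cancel, smul_eq_mul, ← hδ, ← he] at hlow
  linarith

/-- Asymptotic stability when the disturbance vanishes and the parameter is ultimately dominated by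
`b + λ(e^{z_∞})`. -/
theorem IsLyapunovPair.tendsto_V (hP : IsLyapunovPair S Θ b Γ ε c a κ lam k V M)
    (hΘ : Θ.Nonempty) (hS : S.IsRegular Θ) (hΓ : 0 < Γ) (hc : 0 < c) (ha : 0 < a)
    (hκ : IsSmoothKInf κ) (hlam : IsSmoothKInf lam) (hd : IsLInf univ d) (hθ : IsLInf Θ θ)
    (h : ∀ T : ℝ, 0 < T →
      IsSolutionOn (fun t => S.closedLoop k V Γ ε M (θ t) (d t)) w₀ T w) {zInf : ℝ}
    (hz : Tendsto (fun t => (w t).2.2) atTop (𝓝 zInf))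
    (hd0 : Tendsto d essAtTop (𝓝 0))
    (hθ0 : limsup (fun t => ‖θ t‖) essAtTop ≤ b + lam (Real.exp zInf)) :
    Tendsto (fun t => V (w t)) atTop (𝓝 0) := by
  have hM : 0 < M := zero_lt_one.trans_le hP.one_le
  have hbdd : IsBoundedUnder (· ≤ ·) essAtTop fun t => ‖θ t‖ :=
    ⟨supNorm θ, by
      rw [eventually_map, eventually_essAtTop_iff]; exact ⟨0, le_rfl, hθ.ae_norm_le⟩⟩
  have key : ∀ η : ℝ, 0 < η → ∀ᶠ t in atTop, V (w t) ≤ η := by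
    intro η hη
    obtain ⟨δ, hδ, hδη⟩ : ∃ δ : ℝ, 0 < δ ∧ a / M * (5 * δ ^ 2) / c < η / 2 := by
      have h1 : Tendsto (fun δ : ℝ => a / M * (5 * δ ^ 2) / c) (𝓝[>] 0) (𝓝 0) := by
        have : Continuous fun δ : ℝ => a / M * (5 * δ ^ 2) / c := by fun_prop
        have h2 := (this.tendsto 0).mono_left (nhdsWithin_le_nhds (s := Ioi 0))
        simpa using h2
      obtain ⟨δ, h2, h3⟩ := ((h1.eventually_lt_const (half_pos hη)).and
        self_mem_nhdsWithin).exists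
      exact ⟨δ, h3, h2⟩
    have hd1 : ∀ᶠ t in essAtTop, ‖d t‖ ≤ δ := by
      have := (tendsto_zero_iff_norm_tendsto_zero.1 hd0).eventually_le_const hδ
      exact this
    have hθ1 : ∀ᶠ t in essAtTop, ‖θ t‖ ≤ b + lam (Real.exp zInf) + δ := by
      filter_upwards [eventually_lt_of_limsup_lt (lt_of_le_of_lt hθ0 (lt_add_of_pos_right _ hδ))
        hbdd] with t ht using ht.le
    obtain ⟨T₁, hT₁0, hT₁⟩ := eventually_essAtTop_iff.1 (hd1.and hθ1)
    have hlamz : Tendsto (fun t => lam (Real.exp (w t).2.2)) atTop (𝓝 (lam (Real.exp zInf))) :=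
      (hlam.continuous_exp.tendsto zInf).comp hz
    obtain ⟨T₂, hT₂, hT₂'⟩ := ((hlamz.eventually_const_lt (sub_lt_self _ hδ)).and
      (eventually_ge_atTop T₁)).exists
    have hT₂0 : 0 ≤ T₂ := hT₁0.trans hT₂'
    have hT₁' := ae_restrict_of_ae_restrict_of_subset (Ici_subset_Ici.2 hT₂') hT₁
    set g := gain b a M κ lam δ (b + lam (Real.exp zInf) + δ) (w T₂).2.2 with hg
    have hgle : g ≤ a / M * (5 * δ ^ 2) := by
      have h1 := hκ.nonneg_exp (w T₂).2.2
      rw [hg, gain]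
      refine mul_le_mul_of_nonneg_left ?_ (by positivity)
      rw [div_le_iff₀ (by positivity)]
      have h2 : max (b + lam (Real.exp zInf) + δ - b - lam (Real.exp (w T₂).2.2)) 0 ≤ 2 * δ :=
        max_le (by linarith) (by positivity)
      have h3 : max (b + lam (Real.exp zInf) + δ - b - lam (Real.exp (w T₂).2.2)) 0 ^ 2
          ≤ (2 * δ) ^ 2 := pow_le_pow_left₀ (le_max_right _ _) h2 2
      nlinarith [mul_nonneg h1 (sq_nonneg δ)]
    have hexp : Tendsto (fun t => Real.exp (-c * (t - T₂)) * V (w T₂)) atTop (𝓝 0) := by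
      have h1 : Tendsto (fun t : ℝ => -c * (t - T₂)) atTop atBot :=
        (tendsto_atTop_add_const_right _ (-T₂) tendsto_id).const_mul_atTop_of_neg (by linarith)
      simpa using (Real.tendsto_exp_atBot.comp h1).mul_const (V (w T₂))
    filter_upwards [hexp.eventually_le_const (half_pos hη), eventually_ge_atTop T₂,
      eventually_gt_atTop 0] with t ht1 ht2 ht3
    have h1 := hP.decay hΘ hS hΓ hc ha hκ hlam hd hθ (h t ht3) hT₂0 ht2 le_rfl
      (hT₁'.mono fun r hr => hr.1) (hT₁'.mono fun r hr => hr.2) (ζ := (w T₂).2.2) le_rfl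
    obtain ⟨h2, h3⟩ := exp_neg_mul_mem_Icc hc (sub_nonneg.2 ht2)
    have h4 : g / c ≤ η / 2 := le_trans (by gcongr) hδη.le
    have h5 : 0 ≤ g / c := div_nonneg (gain_nonneg ha.le hM.le hκ _ _ _) hc.le
    have h6 := mul_nonneg h5 h2
    linarith
  refine Metric.tendsto_nhds.2 fun η hη => ?_
  filter_upwards [key (η / 2) (half_pos hη)] with t ht
  rw [Real.dist_eq, sub_zero, abs_of_nonneg (hP.V_nonneg _)]
  linarith

/-- Convergence of a bounded trajectory from that of `V`, by positive definiteness and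
compactness. -/
theorem IsLyapunovPair.tendsto_of_tendsto_V (hP : IsLyapunovPair S Θ b Γ ε c a κ lam k V M)
    {C : ℝ} (hC : ∀ t, 0 ≤ t → ‖w t‖ ≤ C) (hV : Tendsto (fun t => V (w t)) atTop (𝓝 0)) :
    Tendsto (fun t => ‖(w t).1‖ + ‖(w t).2.1‖) atTop (𝓝 0) := by
  refine Metric.tendsto_nhds.2 fun η hη => ?_
  set A : Set (State n m) := Metric.closedBall 0 C ∩ {v | η ≤ ‖v.1‖ + ‖v.2.1‖} with hA
  have hAc : IsCompact A := (isCompact_closedBall _ _).inter_right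
    (isClosed_le continuous_const (by fun_prop))
  obtain ⟨μ, hμ, hμA⟩ : ∃ μ : ℝ, 0 < μ ∧ ∀ v ∈ A, μ ≤ V v := by
    by_cases hne : A.Nonempty
    · obtain ⟨v₀, hv₀, hmin⟩ := hAc.exists_isMinOn hne hP.contDiff_V.continuous.continuousOn
      refine ⟨V v₀, hP.V_pos v₀.1 v₀.2.1 v₀.2.2 fun h0 => ?_, fun v hv => hmin hv⟩
      obtain ⟨h1, h2⟩ := Prod.mk.inj h0
      have h3 : η ≤ ‖v₀.1‖ + ‖v₀.2.1‖ := hv₀.2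
      rw [h1, h2, norm_zero, norm_zero] at h3
      linarith
    · exact ⟨1, one_pos, fun v hv => absurd ⟨v, hv⟩ hne⟩
  filter_upwards [hV.eventually_lt_const hμ, eventually_ge_atTop 0] with t ht ht0
  rw [Real.dist_eq, sub_zero, abs_of_nonneg (by positivity)]
  by_contra! hcon
  exact absurd (hμA (w t) ⟨by simpa using hC t ht0, hcon⟩) (not_le.2 ht)

/-- A continuous majorant of the a priori bounds. -/
theorem IsLyapunovPair.exists_continuous_bound (hP : IsLyapunovPair S Θ b Γ ε c a κ lam k V M)
    (hΘ : Θ.Nonempty) (hS : S.IsRegular Θ) (hΓ : 0 < Γ) (hε : 0 < ε) (hc : 0 < c) (ha : 0 < a)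
    (hκ : IsSmoothKInf κ) (hlam : IsSmoothKInf lam) :
    ∃ B : Vec n × Vec m × ℝ × ℝ≥0 × ℝ≥0 → ℝ, Continuous B ∧
      ∀ (x₀ : Vec n) (y₀ : Vec m) (z₀ : ℝ) (d : ℝ → Vec l) (θ : ℝ → Vec p), IsLInf univ d →
      IsLInf Θ θ → ∀ T : ℝ, 0 < T → ∀ w,
      IsSolutionOn (fun t => S.closedLoop k V Γ ε M (θ t) (d t)) (x₀, y₀, z₀) T w →
      ∀ t ∈ Icc 0 T, 2 * ‖w t‖ ≤ B (x₀, y₀, z₀, supNorm d, supNorm θ) := by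
  let A : Vec n × Vec m × ℝ × ℝ≥0 × ℝ≥0 → Set ℝ := fun q =>
    {r | ∀ (d : ℝ → Vec l) (θ : ℝ → Vec p), IsLInf univ d → IsLInf Θ θ →
      supNorm d = q.2.2.2.1 → supNorm θ = q.2.2.2.2 → ∀ T : ℝ, 0 < T → ∀ w,
      IsSolutionOn (fun t => S.closedLoop k V Γ ε M (θ t) (d t)) (q.1, q.2.1, q.2.2.1) T w →
      ∀ t ∈ Icc 0 T, 2 * ‖w t‖ ≤ r}
  have hconv : ∀ q, Convex ℝ (A q) := by
    intro q r hr r' hr' α β hα hβ hαβ d θ hd hθ h1 h2 T hT w hw t ht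
    have e1 := mul_le_mul_of_nonneg_left (hr d θ hd hθ h1 h2 T hT w hw t ht) hα
    have e2 := mul_le_mul_of_nonneg_left (hr' d θ hd hθ h1 h2 T hT w hw t ht) hβ
    have e3 : 2 * ‖w t‖ = α * (2 * ‖w t‖) + β * (2 * ‖w t‖) := by rw [← add_mul, hαβ, one_mul]
    rw [e3]
    exact add_le_add e1 e2
  obtain ⟨B, hB⟩ := exists_continuous_forall_mem_convex_of_local_const hconv (fun q => by
    let ρ : Vec n × Vec m × ℝ × ℝ≥0 × ℝ≥0 → ℝ := fun q =>
      max ‖((q.1, q.2.1, q.2.2.1) : State n m)‖ (max (q.2.2.2.1 : ℝ) (q.2.2.2.2 : ℝ))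
    have hρ : Continuous ρ := by fun_prop
    obtain ⟨C, hC⟩ := hP.exists_bound hΘ hS hΓ hε hc ha hκ hlam (ρ q + 1)
    refine ⟨2 * C, ?_⟩
    filter_upwards [(hρ.tendsto q).eventually_le_const (lt_add_one (ρ q))] with q' hq'
    intro d θ hd hθ h1 h2 T hT w hw t ht
    have h3 := hC _ d θ hd hθ ((le_max_left _ _).trans hq')
      (by rw [h1]; exact ((le_max_left _ _).trans (le_max_right _ _)).trans hq')
      (by rw [h2]; exact ((le_max_right _ _).trans (le_max_right _ _)).trans hq') T hT w hw t ht
    linarith)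
  exact ⟨B, B.continuous, fun x₀ y₀ z₀ d θ hd hθ T hT w hw t ht =>
    hB (x₀, y₀, z₀, supNorm d, supNorm θ) d θ hd hθ rfl rfl T hT w hw t ht⟩

/-- All the properties of the closed loop follow from the dissipation inequality. -/
theorem IsLyapunovPair.closedLoop_properties
    (hP : IsLyapunovPair S Θ b Γ ε c a κ lam k V M)
    (hΘ : Θ.Nonempty) (hS : S.IsRegular Θ) (hΓ : 0 < Γ) (hε : 0 < ε) (hc : 0 < c) (ha : 0 < a)
    (hκ : IsSmoothKInf κ) (hlam : IsSmoothKInf lam) :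
    ∃ B : Vec n × Vec m × ℝ × ℝ≥0 × ℝ≥0 → ℝ, Continuous B ∧
      ∀ (x₀ : Vec n) (y₀ : Vec m) (z₀ : ℝ) (d : ℝ → Vec l) (θ : ℝ → Vec p),
        IsLInf univ d → IsLInf Θ θ →
        ∃ (x : ℝ → Vec n) (y : ℝ → Vec m) (z : ℝ → ℝ) (zInf : ℝ),
          IsUniqueGlobalSolution (fun t => S.closedLoop k V Γ ε M (θ t) (d t))
            (x₀, y₀, z₀) (fun t => (x t, y t, z t)) ∧
          limsup (fun t => ‖x t‖ + |y t 0|) atTop ≤ ε ∧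
          limsup (fun t => V (x t, y t, z t)) atTop ≤ ε ^ 2 / (2 * M) ∧
          Tendsto z atTop (𝓝 zInf) ∧
          (∀ t : ℝ, 0 ≤ t → z₀ ≤ z t ∧ z t ≤ zInf) ∧
          zInf ≤ B (x₀, y₀, z₀, supNorm d, supNorm θ) ∧
          (∀ t : ℝ, 0 ≤ t →
            ‖x t‖ + ‖y t‖ ≤ B (x₀, y₀, z₀, supNorm d, supNorm θ)) ∧
          (∀ t : ℝ, 0 ≤ t →
            ‖x t‖ ^ 2 + |y t 0| ^ 2 ≤ M * V (x t, y t, z t) ∧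
            M * V (x t, y t, z t) ≤ M * Real.exp (-c * t) * V (x₀, y₀, z₀)
              + a * (((supNorm d : ℝ) ^ 2
                  + max ((supNorm θ : ℝ) - b - lam (Real.exp z₀)) 0 ^ 2)
                / (c * (1 + κ (Real.exp z₀))))) ∧
          (Tendsto d essAtTop (𝓝 0) →
            limsup (fun t => ‖θ t‖) essAtTop ≤ b + lam (Real.exp zInf) →
            Tendsto (fun t => ‖x t‖ + ‖y t‖) atTop (𝓝 0)) := by
  obtain ⟨B, hBc, hB⟩ := hP.exists_continuous_bound hΘ hS hΓ hε hc ha hκ hlam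
  refine ⟨B, hBc, fun x₀ y₀ z₀ d θ hd hθ => ?_⟩
  have hM : 0 < M := zero_lt_one.trans_le hP.one_le
  have hVc := hP.contDiff_V.continuous
  set β := B (x₀, y₀, z₀, supNorm d, supNorm θ) with hβ
  obtain ⟨w, hwc, hw⟩ := (isCaratheodory_closedLoop hΘ hS hP.contDiff_k hP.contDiff_V Γ ε M hd
    hθ).exists_global (x₀, y₀, z₀) (max (β / 2) ‖((x₀, y₀, z₀) : State n m)‖) (le_max_right _ _)
    fun T hT v hv t ht => le_max_of_le_left (by
      have := hB x₀ y₀ z₀ d θ hd hθ T hT v hv t ht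
      linarith)
  have hwβ : ∀ t, 0 ≤ t → 2 * ‖w t‖ ≤ β := fun t ht =>
    hB x₀ y₀ z₀ d θ hd hθ (t + 1) (by linarith) w (hw.1 (t + 1) (by linarith)) t
      ⟨ht, by linarith⟩
  have h0 : w 0 = (x₀, y₀, z₀) := (hw.1 1 one_pos).init zero_le_one
  have hmono : ∀ s t, 0 ≤ s → s ≤ t → (w s).2.2 ≤ (w t).2.2 := fun s t hs hst =>
    (hw.1 (t + 1) (by linarith)).z_mono hΓ hVc hs hst (by linarith)
  have hzβ : ∀ t, 0 ≤ t → (w t).2.2 ≤ β := fun t ht => by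
    have h1 := le_trans (le_trans (norm_snd_le (w t).2) (norm_snd_le (w t)))
      (le_refl ‖w t‖)
    have h2 := le_abs_self (w t).2.2
    rw [← Real.norm_eq_abs] at h2
    have := hwβ t ht
    have := norm_nonneg (w t)
    linarith
  obtain ⟨zInf, hz⟩ : ∃ zInf, Tendsto (fun t => (w t).2.2) atTop (𝓝 zInf) := by
    have hmono' : Monotone fun t => (w (max t 0)).2.2 := fun s t hst =>
      hmono _ _ (le_max_right _ _) (max_le_max hst le_rfl)
    have hbdd : BddAbove (range fun t => (w (max t 0)).2.2) :=
      ⟨β, by rintro _ ⟨t, rfl⟩; exact hzβ _ (le_max_right _ _)⟩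
    refine ⟨_, (tendsto_atTop_ciSup hmono' hbdd).congr' ?_⟩
    filter_upwards [eventually_ge_atTop 0] with t ht
    rw [max_eq_left ht]
  have hzle : ∀ t, 0 ≤ t → (w t).2.2 ≤ zInf := fun t ht =>
    ge_of_tendsto hz (by filter_upwards [eventually_ge_atTop t] with s hs using hmono t s ht hs)
  have hev : ∀ η : ℝ, 0 < η → ∀ᶠ t in atTop, V (w t) ≤ ε ^ 2 / (2 * M) + η := fun η hη =>
    hP.eventually_le hΘ hS hΓ hc ha hκ hlam hd hθ hw.1 hz hzle hη
  refine ⟨fun t => (w t).1, fun t => (w t).2.1, fun t => (w t).2.2, zInf, hw, ?_, ?_, hz,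
    fun t ht => ⟨?_, hzle t ht⟩, le_of_tendsto hz ?_, fun t ht => ?_, fun t ht => ⟨?_, ?_⟩, ?_⟩
  · have hcob : IsCoboundedUnder (· ≤ ·) atTop fun t => ‖(w t).1‖ + |(w t).2.1 0| :=
      (isBoundedUnder_of ⟨0, fun t => by positivity⟩ :
        IsBoundedUnder (· ≥ ·) atTop _).isCoboundedUnder_le
    refine le_of_forall_gt_imp_ge_of_dense fun ε' hε' => limsup_le_of_le hcob ?_
    have hη : 0 < (ε' ^ 2 - ε ^ 2) / (2 * M) := by
      have : 0 < ε' ^ 2 - ε ^ 2 := by nlinarith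
      positivity
    filter_upwards [hev _ hη] with t ht
    have h1 := hP.coercive (w t)
    have h2 : M * V (w t) ≤ ε' ^ 2 / 2 := by
      refine (mul_le_mul_of_nonneg_left ht hM.le).trans (le_of_eq ?_)
      field_simp
      ring
    refine abs_le_of_sq_le_sq' ?_ (by linarith) |>.2
    nlinarith [sq_nonneg (‖(w t).1‖ - |(w t).2.1 0|)]
  · have hcob : IsCoboundedUnder (· ≤ ·) atTop fun t => V (w t) :=
      (isBoundedUnder_of ⟨0, fun t => hP.V_nonneg _⟩ :
        IsBoundedUnder (· ≥ ·) atTop _).isCoboundedUnder_le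
    exact le_of_forall_pos_le_add fun η hη => limsup_le_of_le hcob (hev η hη)
  · have := hmono 0 t le_rfl ht
    rwa [h0] at this
  · filter_upwards [eventually_ge_atTop 0] with t ht using hzβ t ht
  · have h1 := norm_fst_le (w t)
    have h2 := (norm_fst_le (w t).2).trans (norm_snd_le (w t))
    have := hwβ t ht
    linarith
  · exact hP.coercive (w t)
  · have h1 := hP.decay hΘ hS hΓ hc ha hκ hlam hd hθ (hw.1 (t + 1) (by linarith)) (s := 0)
      (ζ := z₀) le_rfl ht (by linarith) hd.ae_norm_le hθ.ae_norm_le (by rw [h0])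
    rw [h0, sub_zero] at h1
    obtain ⟨h2, h3⟩ := exp_neg_mul_mem_Icc hc ht
    have h4 : 0 ≤ gain b a M κ lam (supNorm d) (supNorm θ) z₀ / c :=
      div_nonneg (gain_nonneg ha.le hM.le hκ _ _ _) hc.le
    have h5 := mul_nonneg h4 h2
    have h6 : V (w t) ≤ Real.exp (-c * t) * V (x₀, y₀, z₀)
        + gain b a M κ lam (supNorm d) (supNorm θ) z₀ / c := by linarith
    have h7 := mul_le_mul_of_nonneg_left h6 hM.le
    refine h7.trans (le_of_eq ?_)
    have h8 := hκ.nonneg_exp z₀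
    rw [gain]
    field_simp
  · intro hd0 hθ0
    exact hP.tendsto_of_tendsto_V (C := β) (fun t ht => by
      have := hwβ t ht
      have := norm_nonneg (w t)
      linarith) (hP.tendsto_V hΘ hS hΓ hc ha hκ hlam hd hθ hw.1 hz hd0 hθ0)

end closedLoop

/-! ### Linear stabilization of the chain of integrators -/

/-- The operators `s₀ = 1`, `s₁ = σ + ρ`, `s_{i+2} = (σ + ρ) s_{i+1} + s_i` on sequences, `σ` being
the left shift. Applied to the sequence `(x₁, x₂, …)` of successive derivatives, the terms of index
`0` are coordinates in which the chain of integrators is `ṡᵢ = -ρ sᵢ - s_{i-1} + s_{i+1}`: damping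
plus a skew-symmetric coupling. -/
noncomputable def chainOp (ρ : ℝ) : ℕ → (ℕ → ℝ) →ₗ[ℝ] (ℕ → ℝ)
  | 0 => LinearMap.id
  | 1 => LinearMap.funLeft ℝ ℝ (· + 1) + ρ • LinearMap.id
  | (i + 2) => LinearMap.funLeft ℝ ℝ (· + 1) ∘ₗ chainOp ρ (i + 1) + ρ • chainOp ρ (i + 1)
      + chainOp ρ i

theorem chainOp_zero (ρ : ℝ) (v : ℕ → ℝ) (k : ℕ) : chainOp ρ 0 v k = v k := rfl

theorem chainOp_one (ρ : ℝ) (v : ℕ → ℝ) (k : ℕ) : chainOp ρ 1 v k = v (k + 1) + ρ * v k := rfl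

theorem chainOp_add_two (ρ : ℝ) (i : ℕ) (v : ℕ → ℝ) (k : ℕ) : chainOp ρ (i + 2) v k =
    chainOp ρ (i + 1) v (k + 1) + ρ * chainOp ρ (i + 1) v k + chainOp ρ i v k := rfl

/-- `s_i` is triangular with unit leading coefficient. -/
theorem chainOp_of_zero (ρ : ℝ) (v : ℕ → ℝ) : ∀ i k : ℕ, (∀ r < k + i, v r = 0) →
    chainOp ρ i v k = v (k + i)
  | 0, k, _ => rfl
  | 1, k, h => by rw [chainOp_one, h k (by omega), mul_zero, add_zero]
  | (i + 2), k, h => by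
    rw [chainOp_add_two, chainOp_of_zero ρ v (i + 1) (k + 1) fun r hr => h r (by omega),
      chainOp_of_zero ρ v (i + 1) k fun r hr => h r (by omega),
      chainOp_of_zero ρ v i k fun r hr => h r (by omega), h (k + (i + 1)) (by omega),
      h (k + i) (by omega), mul_zero, add_zero, add_zero]
    congr 1
    omega

theorem chainOp_shift (ρ : ℝ) (v : ℕ → ℝ) : ∀ i k : ℕ,
    chainOp ρ i (fun r => v (r + 1)) k = chainOp ρ i v (k + 1)
  | 0, k => rfl
  | 1, k => rfl
  | (i + 2), k => by
    rw [chainOp_add_two, chainOp_add_two, chainOp_shift ρ v (i + 1), chainOp_shift ρ v (i + 1),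
      chainOp_shift ρ v i]

theorem chainOp_congr (ρ : ℝ) {v v' : ℕ → ℝ} {i k : ℕ} (h : ∀ r ≤ k + i, v r = v' r) :
    chainOp ρ i v k = chainOp ρ i v' k := by
  have h1 := chainOp_of_zero ρ (v - v') i k fun r hr => by
    rw [Pi.sub_apply, h r hr.le, sub_self]
  rw [Pi.sub_apply, h (k + i) le_rfl, sub_self, map_sub, Pi.sub_apply] at h1
  linarith

/-- The skew-symmetric couplings telescope. -/
theorem sum_chainOp_mul (ρ : ℝ) (v : ℕ → ℝ) (r : ℕ) :
    ∑ i ∈ Finset.range (r + 1), chainOp ρ i v 0 * chainOp ρ i v 1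
      = -ρ * ∑ i ∈ Finset.range (r + 1), chainOp ρ i v 0 ^ 2
        + chainOp ρ r v 0 * chainOp ρ (r + 1) v 0 := by
  induction r with
  | zero => simp [chainOp_zero, chainOp_one]; ring
  | succ r ih =>
    rw [Finset.sum_range_succ, ih, Finset.sum_range_succ (fun i => chainOp ρ i v 0 ^ 2) (r + 1),
      chainOp_add_two]
    ring

/-- The sequence `(x₁, …, x_n, 0, 0, …)`. -/
noncomputable def seqOf (n : ℕ) : Vec n →ₗ[ℝ] (ℕ → ℝ) where
  toFun x i := if h : i < n then x ⟨i, h⟩ else 0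
  map_add' x x' := by ext i; simp only [Pi.add_apply, PiLp.add_apply]; split_ifs <;> simp
  map_smul' r x := by
    ext i; simp only [Pi.smul_apply, PiLp.smul_apply, RingHom.id_apply]; split_ifs <;> simp

/-- The change of coordinates `x ↦ (s₀, …, s_{n-1})`. -/
noncomputable def chainCoord (ρ : ℝ) (n : ℕ) : Vec n →L[ℝ] Vec n :=
  LinearMap.toContinuousLinearMap
    { toFun := fun x => WithLp.toLp 2 fun i : Fin n => chainOp ρ i (seqOf n x) 0
      map_add' := fun x x' => by ext i; simp
      map_smul' := fun r x => by ext i; simp }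

theorem chainCoord_apply (ρ : ℝ) (n : ℕ) (x : Vec n) (i : Fin n) :
    chainCoord ρ n x i = chainOp ρ i (seqOf n x) 0 := rfl

theorem chainCoord_injective (ρ : ℝ) (n : ℕ) :
    LinearMap.ker (chainCoord ρ n : Vec n →ₗ[ℝ] Vec n) = ⊥ := by
  refine LinearMap.ker_eq_bot'.2 fun x hx => ?_
  have hx' : ∀ i : Fin n, chainOp ρ i (seqOf n x) 0 = 0 := fun i =>
    congrArg (fun u : Vec n => u i) hx
  have key : ∀ i : ℕ, ∀ h : i < n, x ⟨i, h⟩ = 0 := by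
    intro i
    induction i using Nat.strong_induction_on with
    | _ i ih =>
      intro h
      have h1 := chainOp_of_zero ρ (seqOf n x) i 0 fun r hr => by
        have hr' : r < i := by omega
        simp only [seqOf, LinearMap.coe_mk, AddHom.coe_mk]
        rw [dif_pos (hr'.trans h), ih r hr' (hr'.trans h)]
      rw [hx' ⟨i, h⟩, zero_add] at h1
      simp only [seqOf, LinearMap.coe_mk, AddHom.coe_mk, dif_pos h] at h1
      exact h1.symm
  ext i
  exact key i i.2

/-- A quadratic Lyapunov function and a linear virtual control `y₁ = ℓ x` giving the chain of
integrators an arbitrary decay rate. -/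
theorem exists_chain_lyapunov (n m : ℕ) [NeZero n] [NeZero m] (c : ℝ) :
    ∃ (V : Vec n → ℝ) (ℓ : Vec n →L[ℝ] ℝ) (C M : ℝ), ContDiff ℝ ∞ V ∧ V 0 = 0 ∧ (∀ x, 0 ≤ V x) ∧
      0 ≤ C ∧ (∀ x, ‖x‖ ≤ C * √(V x)) ∧ 1 ≤ M ∧
      (∀ x (r : ℝ), ‖x‖ ^ 2 + |r| ^ 2 ≤ M * (V x + (r - ℓ x) ^ 2 / 2)) ∧
      ∀ x (y : Vec m), fderiv ℝ V x (System.xDot x y) ≤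
        -c * V x + 2 * √(V x) * |y 0 - ℓ x| := by
  set ρ := c / 2 with hρ
  set T := chainCoord ρ n with hT
  let ℓ : Vec n →L[ℝ] ℝ := LinearMap.toContinuousLinearMap
    { toFun := fun x => -chainOp ρ n (seqOf n x) 0
      map_add' := fun x x' => by simp; ring
      map_smul' := fun r x => by simp }
  have hℓ : ∀ x, ℓ x = -chainOp ρ n (seqOf n x) 0 := fun x => rfl
  obtain ⟨K, hK, hTK⟩ := LinearMap.exists_antilipschitzWith (T : Vec n →ₗ[ℝ] Vec n)
    (chainCoord_injective ρ n)
  have hxT : ∀ x, ‖x‖ ≤ K * ‖T x‖ := fun x => by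
    have := hTK.le_mul_dist x 0
    simpa using this
  let V : Vec n → ℝ := fun x => ‖T x‖ ^ 2 / 2
  have hsq : ∀ x, ‖T x‖ ≤ 2 * √(V x) := by
    intro x
    have h1 : √(V x) ^ 2 = ‖T x‖ ^ 2 / 2 := Real.sq_sqrt (by positivity)
    refine abs_le_of_sq_le_sq' ?_ (by positivity) |>.2
    rw [mul_pow, h1]
    nlinarith [sq_nonneg ‖T x‖]
  refine ⟨V, ℓ, 2 * K, (1 + 2 * ‖ℓ‖ ^ 2) * (2 * K ^ 2) + 4, ?_, ?_, fun x => by positivity,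
    by positivity, fun x => ?_, ?_, fun x r => ?_, fun x y => ?_⟩
  · exact (T.contDiff.norm_sq ℝ).div_const 2
  · simp [V]
  · exact (hxT x).trans (by
      have := mul_le_mul_of_nonneg_left (hsq x) K.2
      simp only [NNReal.val_eq_coe] at this
      linarith)
  · have : 0 ≤ (1 + 2 * ‖ℓ‖ ^ 2) * (2 * (K : ℝ) ^ 2) := by positivity
    linarith
  · have h1 : ‖x‖ ^ 2 ≤ (2 * K ^ 2) * V x := by
      have := pow_le_pow_left₀ (norm_nonneg x) (hxT x) 2
      rw [mul_pow] at this
      simp only [V]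
      linarith
    have h2 : (ℓ x) ^ 2 ≤ ‖ℓ‖ ^ 2 * ‖x‖ ^ 2 := by
      have := pow_le_pow_left₀ (norm_nonneg _) (ℓ.le_opNorm x) 2
      rwa [mul_pow, Real.norm_eq_abs, sq_abs] at this
    have h3 : r ^ 2 ≤ 2 * (r - ℓ x) ^ 2 + 2 * (ℓ x) ^ 2 := by nlinarith [sq_nonneg (r - 2 * ℓ x)]
    have h4 : 0 ≤ V x := by positivity
    have h5 : (1 + 2 * ‖ℓ‖ ^ 2) * ‖x‖ ^ 2 ≤ (1 + 2 * ‖ℓ‖ ^ 2) * ((2 * K ^ 2) * V x) :=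
      mul_le_mul_of_nonneg_left h1 (by positivity)
    have h6 : 0 ≤ (1 + 2 * ‖ℓ‖ ^ 2) * (2 * (K : ℝ) ^ 2) * (r - ℓ x) ^ 2 := by positivity
    rw [sq_abs]
    nlinarith
  · set v : ℕ → ℝ := seqOf n x + Pi.single n (y 0) with hv
    have hvlt : ∀ r < n, v r = seqOf n x r := fun r hr => by
      simp [hv, Pi.single_eq_of_ne hr.ne]
    have hcoord : ∀ i : Fin n, T x i = chainOp ρ i v 0 := fun i => by
      rw [hT, chainCoord_apply]
      exact chainOp_congr ρ fun r hr => (hvlt r (by have := i.2; omega)).symm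
    have hdot : ∀ i : Fin n, T (System.xDot x y) i = chainOp ρ i v 1 := fun i => by
      rw [hT, chainCoord_apply, ← chainOp_shift ρ v i 0]
      refine chainOp_congr ρ fun r hr => ?_
      have hr' : r < n := by have := i.2; omega
      simp only [seqOf, System.xDot, LinearMap.coe_mk, AddHom.coe_mk, dif_pos hr', hv, Pi.add_apply]
      by_cases h1 : r + 1 < n
      · rw [dif_pos h1, dif_pos h1, Pi.single_eq_of_ne h1.ne, add_zero]
      · have h2 : r + 1 = n := by omega
        rw [dif_neg h1, dif_neg h1, h2, Pi.single_eq_same, zero_add]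
    have hlast : chainOp ρ n v 0 = y 0 - ℓ x := by
      rw [hv, map_add, Pi.add_apply, hℓ, chainOp_of_zero ρ (Pi.single n (y 0)) n 0 fun r hr =>
        Pi.single_eq_of_ne (by omega) _, zero_add, Pi.single_eq_same]
      ring
    have hder : fderiv ℝ V x (System.xDot x y) = inner ℝ (T x) (T (System.xDot x y)) := by
      have h1 := (T.hasFDerivAt (x := x)).norm_sq.mul_const (2⁻¹ : ℝ)
      simp only [← div_eq_mul_inv] at h1
      rw [h1.fderiv]
      simp
    obtain ⟨r, hr⟩ : ∃ r, n = r + 1 := ⟨n - 1, by have := NeZero.pos n; omega⟩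
    have hsum : inner ℝ (T x) (T (System.xDot x y))
        = ∑ i ∈ Finset.range (r + 1), chainOp ρ i v 0 * chainOp ρ i v 1 := by
      rw [← hr, ← Fin.sum_univ_eq_sum_range (fun i => chainOp ρ i v 0 * chainOp ρ i v 1),
        PiLp.inner_apply]
      refine Finset.sum_congr rfl fun i _ => ?_
      rw [hcoord, hdot]
      simp [mul_comm]
    have hnorm : ∑ i ∈ Finset.range (r + 1), chainOp ρ i v 0 ^ 2 = ‖T x‖ ^ 2 := by
      rw [← hr, ← Fin.sum_univ_eq_sum_range (fun i => chainOp ρ i v 0 ^ 2),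
        EuclideanSpace.real_norm_sq_eq]
      exact Finset.sum_congr rfl fun i _ => by rw [hcoord]
    have hle : |chainOp ρ r v 0| ≤ ‖T x‖ := by
      have h1 := PiLp.norm_apply_le (T x) (⟨r, by omega⟩ : Fin n)
      rwa [hcoord] at h1
    rw [hder, hsum, sum_chainOp_mul, hnorm, ← hr, hlast]
    have h2 : chainOp ρ r v 0 * (y 0 - ℓ x) ≤ 2 * √(V x) * |y 0 - ℓ x| := by
      refine (le_abs_self _).trans ?_
      rw [abs_mul]
      exact mul_le_mul_of_nonneg_right (hle.trans (hsq x)) (abs_nonneg _)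
    have h3 : -ρ * ‖T x‖ ^ 2 = -c * V x := by simp only [V, hρ]; ring
    linarith

/-! ### Domination by continuous and by smooth functions -/

theorem exists_contDiff_ge {E : Type*} [NormedAddCommGroup E] [NormedSpace ℝ E]
    [FiniteDimensional ℝ E] {f : E → ℝ} (hf : Continuous f) :
    ∃ K : E → ℝ, ContDiff ℝ ∞ K ∧ ∀ v, f v ≤ K v := by
  obtain ⟨K, hK⟩ := exists_contMDiffMap_forall_mem_convex_of_local_const (n := (⊤ : ℕ∞))
    (modelWithCornersSelf ℝ E) (t := fun v => Ici (f v)) (fun v => convex_Ici _) fun v =>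
      ⟨f v + 1, (hf.tendsto v).eventually_le_const (lt_add_one _)⟩
  exact ⟨K, contMDiff_iff_contDiff.1 K.contMDiff, hK⟩

/-- The size of the part `(x, y)` of the state. -/
noncomputable def xySize (w : State n m) : ℝ := ‖w.1‖ + ‖w.2.1‖

theorem xySize_nonneg (w : State n m) : 0 ≤ xySize w := by unfold xySize; positivity

theorem continuous_xySize : Continuous (xySize : State n m → ℝ) := by
  unfold xySize; fun_prop

/-- A smooth map vanishing for `(x, y) = 0` is bounded by a continuous multiple of the size of
`(x, y)`. -/
theorem exists_le_mul_xySize {F : Type*} [NormedAddCommGroup F] [NormedSpace ℝ F]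
    {f : State n m → F} (hf : ContDiff ℝ ∞ f) (h0 : ∀ z, f (0, 0, z) = 0) :
    ∃ C : State n m → ℝ, Continuous C ∧ (∀ v, 0 ≤ C v) ∧ ∀ v, ‖f v‖ ≤ C v * xySize v := by
  obtain ⟨C, hC⟩ := exists_continuous_forall_mem_convex_of_local_const
    (t := fun v : State n m => {C : ℝ | 0 ≤ C ∧ ‖f v‖ ≤ C * xySize v}) (fun v => by
      intro r hr r' hr' α β hα hβ hαβ
      have e1 := mul_le_mul_of_nonneg_left hr.2 hα
      have e2 := mul_le_mul_of_nonneg_left hr'.2 hβ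
      refine ⟨add_nonneg (mul_nonneg hα hr.1) (mul_nonneg hβ hr'.1), ?_⟩
      have e3 : ‖f v‖ = α * ‖f v‖ + β * ‖f v‖ := by rw [← add_mul, hαβ, one_mul]
      rw [e3, smul_eq_mul, smul_eq_mul]
      linarith) (fun v₀ => by
      rcases (xySize_nonneg v₀).eq_or_lt with hX | hX
      · obtain ⟨K, t, ht, hK⟩ := ((hf.of_le (show (1 : ℕ∞ω) ≤ ∞ by
          exact_mod_cast le_top)).contDiffAt (x := v₀)).exists_lipschitzOnWith
        have h1 : v₀.1 = 0 ∧ v₀.2.1 = 0 := by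
          have e1 := norm_nonneg v₀.1
          have e2 := norm_nonneg v₀.2.1
          unfold xySize at hX
          exact ⟨norm_eq_zero.1 (by linarith), norm_eq_zero.1 (by linarith)⟩
        have h2 : Continuous fun v : State n m => ((0, 0, v.2.2) : State n m) := by fun_prop
        have h3 : ((0, 0, v₀.2.2) : State n m) = v₀ :=
          Prod.ext h1.1.symm (Prod.ext h1.2.symm rfl)
        have h4 := h2.tendsto v₀
        simp only [h3] at h4
        refine ⟨K, ?_⟩
        filter_upwards [ht, h4.eventually_mem ht] with v hv hv'
        refine ⟨K.2, ?_⟩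
        have h5 := hK.norm_sub_le hv hv'
        rw [h0, sub_zero] at h5
        refine h5.trans (mul_le_mul_of_nonneg_left ?_ K.2)
        rw [Prod.norm_def, Prod.norm_def]
        simp only [Prod.fst_sub, Prod.snd_sub, sub_zero, sub_self, norm_zero, xySize]
        have e1 := norm_nonneg v.1
        have e2 := norm_nonneg v.2.1
        exact max_le (by linarith) (max_le (by linarith) (by linarith))
      · refine ⟨(‖f v₀‖ + 1) / (xySize v₀ / 2), ?_⟩
        filter_upwards [(hf.continuous.norm.tendsto v₀).eventually_le_const (lt_add_one _),
          (continuous_xySize.tendsto v₀).eventually_const_le (half_lt_self hX)] with v h1 h2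
        refine ⟨by positivity, h1.trans ?_⟩
        rw [div_mul_eq_mul_div, le_div_iff₀ (half_pos hX)]
        exact mul_le_mul_of_nonneg_left h2 (by positivity))
  exact ⟨C, C.continuous, fun v => (hC v).1, fun v => (hC v).2⟩

/-! ### Backstepping -/

/-- The projection of `y` onto its first `j` coordinates. -/
noncomputable def low (j : ℕ) : Vec m →L[ℝ] Vec m :=
  LinearMap.toContinuousLinearMap
    { toFun := fun y => WithLp.toLp 2 fun i : Fin m => if (i : ℕ) < j then y i else 0
      map_add' := fun y y' => by
        ext i; simp only [PiLp.add_apply]; split_ifs <;> simp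
      map_smul' := fun r y => by
        ext i; simp only [PiLp.smul_apply, RingHom.id_apply]; split_ifs <;> simp }

theorem low_apply (j : ℕ) (y : Vec m) (i : Fin m) :
    low j y i = if (i : ℕ) < j then y i else 0 := rfl

/-- The projection of the state `(x, y, z)` onto `(x, (y₁, …, y_j), z)`. -/
noncomputable def proj (n : ℕ) {m : ℕ} (j : ℕ) : State n m →L[ℝ] State n m :=
  (ContinuousLinearMap.fst ℝ _ _).prod
    (((low j).comp ((ContinuousLinearMap.fst ℝ _ _).comp (ContinuousLinearMap.snd ℝ _ _))).prod
      ((ContinuousLinearMap.snd ℝ _ _).comp (ContinuousLinearMap.snd ℝ _ _)))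

theorem proj_apply (j : ℕ) (w : State n m) : proj n j w = (w.1, low j w.2.1, w.2.2) := rfl

theorem proj_proj {i j : ℕ} (h : i ≤ j) (w : State n m) : proj n i (proj n j w) = proj n i w := by
  refine Prod.ext rfl (Prod.ext ?_ rfl)
  ext r
  simp only [proj_apply, low_apply]
  split_ifs <;> first | rfl | omega

theorem proj_top {j : ℕ} (h : m ≤ j) (w : State n m) : proj n j w = w := by
  refine Prod.ext rfl (Prod.ext ?_ rfl)
  ext r
  simp only [proj_apply, low_apply]
  rw [if_pos (r.2.trans_le h)]

theorem trunc_proj (i : Fin m) {j : ℕ} (h : (i : ℕ) < j) (y : Vec m) :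
    trunc i (low j y) = trunc i y := by
  ext r
  simp only [trunc, low_apply, Fin.val_castLE]
  rw [if_pos (by have := r.2; omega)]

theorem argL_proj (i : Fin m) {j : ℕ} (h : (i : ℕ) < j) (w : State n m) :
    argL n i (proj n j w) = argL n i w := by
  rw [argL_apply, argL_apply, proj_apply, trunc_proj i h]

/-- The velocity of the state for the values `u`, `θ`, `d` of the inputs and `ζ` of `ż`. -/
noncomputable def field [NeZero m] (S : System n m p l) (w : State n m) (u : ℝ) (θ : Vec p)
    (d : Vec l) (ζ : ℝ) : State n m := (System.xDot w.1 w.2.1, S.yDot w.1 w.2.1 u θ d, ζ)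

/-- The quantity `y_{j+1}` (with `y_{m+1} = u`) acting as a control input for `(x, y₁, …, y_j)`. -/
def nextInput (j : ℕ) (w : State n m) (u : ℝ) : ℝ := if h : j < m then w.2.1 ⟨j, h⟩ else u

/-- Stage `j` of the backstepping: a function `V` and a virtual control `k` for the subsystem
`(x, y₁, …, y_j)`, with `y_{j+1}` as the input. In the dissipation inequality `E` stands for the
part of the complete Lyapunov function that the later stages add; it enters because `ż` is at most
`Γ e^{-z}` times the complete Lyapunov function. The terms with `E` and with the error
`y_{j+1} - k` are what the next stage has to absorb, which is why their coefficients `Q` and `G`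
are bounded by functions of `(x, y₁, …, y_j, z)`, up to the factor `1 + |θ|`. -/
structure IsStage [NeZero m] (S : System n m p l) (Θ : Set (Vec p)) (b Γ : ℝ) (κ lam : ℝ → ℝ)
    (M c σ : ℝ) (j : ℕ) (V k : State n m → ℝ) : Prop where
  contDiff_V : ContDiff ℝ ∞ V
  contDiff_k : ContDiff ℝ ∞ k
  V_proj : ∀ w, V (proj n j w) = V w
  k_proj : ∀ w, k (proj n j w) = k w
  V_zero : ∀ z, V (0, 0, z) = 0
  k_zero : ∀ z, k (0, 0, z) = 0
  V_nonneg : ∀ w, 0 ≤ V w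
  posDef : ∃ C : State n m → ℝ, Continuous C ∧ (∀ w, 0 ≤ C w) ∧
    ∀ w, xySize (proj n j w) ≤ C (proj n j w) * √(V w)
  proper : ∀ R : ℝ, ∃ C : ℝ, ∀ w : State n m, |w.2.2| ≤ R → V w ≤ R → ‖proj n j w‖ ≤ C
  coercive : ∀ (w : State n m) (u : ℝ),
    ‖w.1‖ ^ 2 + |w.2.1 0| ^ 2 ≤ M * (V w + (nextInput j w u - k w) ^ 2 / 2)
  dissip : ∃ (Q : State n m → ℝ) (G : State n m → Vec p → ℝ), Continuous Q ∧ (∀ w, 0 ≤ Q w) ∧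
    (∀ (w : State n m) (u : ℝ), ∀ θ ∈ Θ, ∀ (d : Vec l) (ζ E : ℝ), 0 ≤ E → 0 ≤ ζ →
      ζ ≤ Γ * Real.exp (-w.2.2) * (V w + E) →
      fderiv ℝ V w (field S w u θ d ζ) ≤ -c * V w
        + σ / (1 + κ (Real.exp w.2.2)) * (‖d‖ ^ 2 + max (‖θ‖ - b - lam (Real.exp w.2.2)) 0 ^ 2)
        + E * Q (proj n j w) + G w θ * |nextInput j w u - k w|) ∧
    (j < m → ∃ ρ : State n m → ℝ, Continuous ρ ∧ (∀ w, 0 ≤ ρ w) ∧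
      ∀ w, ∀ θ ∈ Θ, G w θ ≤ ρ (proj n j w) * √(V w) * (1 + ‖θ‖))

/-- A complete backstepping design is a Lyapunov pair. -/
theorem IsStage.isLyapunovPair [NeZero m] {S : System n m p l} {Θ : Set (Vec p)}
    {b Γ ε c a : ℝ} {κ lam : ℝ → ℝ} {M : ℝ} {V k : State n m → ℝ} (hΓ : 0 < Γ) (hM : 1 ≤ M)
    (h : IsStage S Θ b Γ κ lam M c (a / M) m V k) :
    IsLyapunovPair S Θ b Γ ε c a κ lam k V M where
  contDiff_k := h.contDiff_k
  contDiff_V := h.contDiff_V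
  k_zero := h.k_zero
  V_zero := h.V_zero
  V_pos := by
    intro x y z hxy
    obtain ⟨C, -, -, hC⟩ := h.posDef
    refine (h.V_nonneg _).lt_of_ne fun h0 => hxy ?_
    have h1 := hC (x, y, z)
    rw [← h0, Real.sqrt_zero, mul_zero, proj_top le_rfl] at h1
    have e1 := norm_nonneg x
    have e2 := norm_nonneg y
    unfold xySize at h1
    exact Prod.ext (norm_eq_zero.1 (by linarith)) (norm_eq_zero.1 (by linarith))
  one_le := hM
  coercive := by
    intro w
    have h1 := h.coercive w (k w)
    have h2 : nextInput m w (k w) = k w := by simp [nextInput]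
    rw [h2] at h1
    simpa using h1
  proper := by
    intro R
    obtain ⟨C, hC⟩ := h.proper R
    refine ⟨C, fun w h1 h2 => ?_⟩
    have := hC w h1 h2
    rwa [proj_top le_rfl] at this
  dissip := by
    intro w θ hθ d
    obtain ⟨Q, G, -, -, h1, -⟩ := h.dissip
    have h2 : nextInput m w (k w) = k w := by simp [nextInput]
    have hζ : max (V w - ε ^ 2 / (2 * M)) 0 ≤ V w + 0 := by
      have : 0 ≤ ε ^ 2 / (2 * M) := by positivity
      exact max_le (by linarith) (by linarith [h.V_nonneg w])
    have h3 := h1 w (k w) θ hθ d (Γ * Real.exp (-w.2.2) * max (V w - ε ^ 2 / (2 * M)) 0) 0 le_rfl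
      (mul_nonneg (by positivity) (le_max_right _ _))
      (mul_le_mul_of_nonneg_left hζ (by positivity))
    rw [h2, sub_self, abs_zero, mul_zero, zero_mul, add_zero, add_zero] at h3
    refine h3.trans (le_of_eq ?_)
    rw [gain]
    ring

/-- The initial stage: the chain of integrators. -/
theorem exists_isStage_zero [NeZero n] [NeZero m] (S : System n m p l) (Θ : Set (Vec p)) (b Γ : ℝ)
    (κ lam : ℝ → ℝ) (c : ℝ) :
    ∃ M : ℝ, 1 ≤ M ∧ ∃ V k : State n m → ℝ, IsStage S Θ b Γ κ lam M c 0 0 V k := by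
  obtain ⟨V, ℓ, C, M, hV, hV0, hVn, hC0, hC, hM, hco, hdis⟩ := exists_chain_lyapunov n m c
  have hnext : ∀ (w : State n m) u, nextInput 0 w u = w.2.1 0 := fun w u => by
    simp only [nextInput, dif_pos (NeZero.pos m)]; rfl
  have hlow : ∀ y : Vec m, low 0 y = 0 := fun y => by ext i; simp [low_apply]
  refine ⟨M, hM, fun w => V w.1, fun w => ℓ w.1, ?_⟩
  refine ⟨hV.comp contDiff_fst, ℓ.contDiff.comp contDiff_fst, fun w => rfl, fun w => rfl,
    fun z => hV0, fun z => map_zero ℓ, fun w => hVn _, ⟨fun _ => C, continuous_const, fun _ => hC0,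
    fun w => ?_⟩, fun R => ⟨max (C * √R) (max 0 R), fun w h1 h2 => ?_⟩, fun w u => ?_,
    fun _ => 0, fun w _ => 2 * √(V w.1), continuous_const, fun _ => le_rfl, ?_, fun _ =>
    ⟨fun _ => 2, continuous_const, fun _ => by norm_num, fun w θ _ => ?_⟩⟩
  · rw [proj_apply, xySize, hlow]
    simpa using hC w.1
  · rw [proj_apply, hlow]
    refine max_le_max ((hC w.1).trans ?_) (max_le_max (by simp) h1)
    exact mul_le_mul_of_nonneg_left (Real.sqrt_le_sqrt h2) hC0
  · rw [hnext]
    exact hco w.1 (w.2.1 0)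
  · intro w u θ hθ d ζ E hE hζ hζE
    have h1 : HasFDerivAt (fun w : State n m => V w.1)
        ((fderiv ℝ V w.1).comp (ContinuousLinearMap.fst ℝ _ _)) w :=
      ((hV.differentiable (by simp)).differentiableAt.hasFDerivAt).comp w hasFDerivAt_fst
    rw [h1.fderiv, hnext, zero_div, zero_mul, mul_zero, add_zero, add_zero]
    exact hdis w.1 w.2.1
  · have : 0 ≤ 2 * √(V w.1) := by positivity
    nlinarith [norm_nonneg θ]

/-- The completion of squares in the backstepping step. -/
theorem young_backstepping {e C A T D Λ q γ τ V : ℝ} (he : 0 ≤ e) (hC : 0 ≤ C) (hA : 0 ≤ A)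
    (hT : T ≤ Λ + q) (hτ : 0 < τ) (hV : A ^ 2 = V) :
    e * (C * (A * T + D + γ * A ^ 2)) ≤ V + τ * (D ^ 2 + q ^ 2)
      + e ^ 2 * (C ^ 2 * (Λ + γ * A) ^ 2 / 4 + C ^ 2 * V / (4 * τ) + C ^ 2 / (4 * τ)) := by
  have h1 : e * (C * (A * T)) ≤ e * (C * (A * (Λ + q))) := by gcongr
  have h2 : (e * C * (Λ + γ * A)) * A ≤ V + (e * C * (Λ + γ * A)) ^ 2 / 4 := by
    nlinarith [sq_nonneg (A - e * C * (Λ + γ * A) / 2)]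
  have h3 : ∀ X Y : ℝ, X * Y ≤ τ * Y ^ 2 + X ^ 2 / (4 * τ) := by
    intro X Y
    have : τ * Y ^ 2 + X ^ 2 / (4 * τ) - X * Y = (2 * τ * Y - X) ^ 2 / (4 * τ) := by
      field_simp; ring
    have h4 : 0 ≤ (2 * τ * Y - X) ^ 2 / (4 * τ) := by positivity
    linarith
  have h5 := h3 (e * C * A) q
  have h6 := h3 (e * C) D
  have h7 : (e * C * A) ^ 2 / (4 * τ) = e ^ 2 * (C ^ 2 * V / (4 * τ)) := by rw [← hV]; ring
  have h8 : (e * C) ^ 2 / (4 * τ) = e ^ 2 * (C ^ 2 / (4 * τ)) := by ring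
  rw [h7] at h5
  rw [h8] at h6
  nlinarith

/-- The drift and disturbance terms of the equation for `y_{i+1}`. -/
theorem exists_drift_le {S : System n m p l} {Θ : Set (Vec p)} (hS : S.IsRegular Θ) (i : Fin m) :
    ∃ C : State n m → ℝ, Continuous C ∧ (∀ v, 0 ≤ C v) ∧ ∀ (v : State n m) (θ : Vec p) (d : Vec l),
      |S.h i (argL n i v) + inner ℝ (S.φ i (argL n i v)) θ + inner ℝ (S.α i (argL n i v)) d|
        ≤ C v * (xySize v * (1 + ‖θ‖) + ‖d‖) := by
  have hz : ∀ z : ℝ, argL n i ((0, 0, z) : State n m) = 0 := fun z => by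
    rw [argL_apply]; exact Prod.ext rfl (map_zero (truncL i))
  obtain ⟨Ch, hChc, hCh0, hCh⟩ := exists_le_mul_xySize
    (f := fun v : State n m => S.h i (argL n i v)) ((hS.smooth_h i).comp (argL n i).contDiff)
    (fun z => by rw [hz, hS.h_zero])
  obtain ⟨Cφ, hCφc, hCφ0, hCφ⟩ := exists_le_mul_xySize
    (f := fun v : State n m => S.φ i (argL n i v)) ((hS.smooth_φ i).comp (argL n i).contDiff)
    (fun z => by rw [hz, hS.φ_zero])
  have hαc := (hS.smooth_α i).continuous
  refine ⟨fun v => Ch v + Cφ v + ‖S.α i (argL n i v)‖, by fun_prop,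
    fun v => add_nonneg (add_nonneg (hCh0 v) (hCφ0 v)) (norm_nonneg _), fun v θ d => ?_⟩
  have hX := xySize_nonneg v
  have b1 : |S.h i (argL n i v)| ≤ Ch v * xySize v := hCh v
  have b3 : |inner ℝ (S.φ i (argL n i v)) θ| ≤ Cφ v * xySize v * ‖θ‖ :=
    (abs_real_inner_le_norm _ _).trans (mul_le_mul_of_nonneg_right (hCφ v) (norm_nonneg _))
  have b4 : |inner ℝ (S.α i (argL n i v)) d| ≤ ‖S.α i (argL n i v)‖ * ‖d‖ :=
    abs_real_inner_le_norm _ _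
  have hd := norm_nonneg d
  have hθn := norm_nonneg θ
  have hα := norm_nonneg (S.α i (argL n i v))
  refine (abs_add_le _ _).trans ((add_le_add_left (abs_add_le _ _) _).trans ?_)
  have p1 := mul_nonneg (mul_nonneg (hCh0 v) hX) hθn
  have p2 := mul_nonneg (hCφ0 v) hX
  have p3 := mul_nonneg (add_nonneg (hCh0 v) (hCφ0 v)) hd
  have p4 := mul_nonneg hα (mul_nonneg hX (by positivity : (0 : ℝ) ≤ 1 + ‖θ‖))
  nlinarith

/-- The velocity of `(x, y₁, …, y_j)` is bounded in terms of the size of `(x, y₁, …, y_{j+1})`. -/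
theorem exists_norm_proj_field_le [NeZero m] {S : System n m p l} {Θ : Set (Vec p)}
    (hS : S.IsRegular Θ) (hg : S.HasGainBounds Θ) {j : ℕ} (hj : j < m) :
    ∃ C : State n m → ℝ, Continuous C ∧ (∀ w, 0 ≤ C w) ∧
      ∀ (w : State n m) (u : ℝ), ∀ θ ∈ Θ, ∀ (d : Vec l) (ζ : ℝ), 0 ≤ ζ →
        ‖proj n j (field S w u θ d ζ)‖ ≤ C (proj n (j + 1) w) *
          (xySize (proj n (j + 1) w) * (1 + ‖θ‖) + ‖d‖ + ζ) := by
  have hcomp : ∀ i : Fin m, ∃ C : State n m → ℝ, Continuous C ∧ (∀ w, 0 ≤ C w) ∧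
      ∀ (w : State n m) (u : ℝ), ∀ θ ∈ Θ, ∀ (d : Vec l), (i : ℕ) < j →
        |S.yDot w.1 w.2.1 u θ d i| ≤ C (proj n (j + 1) w) *
          (xySize (proj n (j + 1) w) * (1 + ‖θ‖) + ‖d‖) := by
    intro i
    by_cases hij : (i : ℕ) < j
    swap
    · exact ⟨fun _ => 0, continuous_const, fun _ => le_rfl, fun w u θ _ d h => absurd h hij⟩
    have him : (i : ℕ) + 1 < m := by omega
    obtain ⟨η, -, hη0, hη⟩ := hg.1 i
    obtain ⟨μ, hμc, hμ0, hμ⟩ := hg.2 i him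
    obtain ⟨Cf, hCfc, hCf0, hCf⟩ := exists_drift_le hS i
    have hμc' := hμc.continuous
    refine ⟨fun v => Cf v + μ (argL n i v), by fun_prop,
      fun v => add_nonneg (hCf0 v) (hμ0 _).le, fun w u θ hθ d _ => ?_⟩
    set v := proj n (j + 1) w with hv
    have harg : (w.1, trunc i w.2.1) = argL n i v := by
      rw [hv, argL_proj i (by omega), argL_apply]
    have hy : w.2.1 ⟨i + 1, him⟩ = v.2.1 ⟨i + 1, him⟩ := by
      rw [hv, proj_apply]
      simp only [low_apply]
      rw [if_pos (by simpa using hij)]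
    have hX := xySize_nonneg v
    have hyX : |v.2.1 ⟨i + 1, him⟩| ≤ xySize v := by
      have h1 := PiLp.norm_apply_le v.2.1 (⟨i + 1, him⟩ : Fin m)
      rw [Real.norm_eq_abs] at h1
      unfold xySize
      linarith [norm_nonneg v.1]
    have hg1 : |S.g i (argL n i v, θ)| ≤ μ (argL n i v) * (1 + ‖θ‖) := by
      rw [abs_of_nonneg ((hη0 _).le.trans (hη _ θ hθ))]
      exact hμ _ θ hθ
    have e : S.yDot w.1 w.2.1 u θ d i = (S.h i (argL n i v) + inner ℝ (S.φ i (argL n i v)) θ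
        + inner ℝ (S.α i (argL n i v)) d) + S.g i (argL n i v, θ) * v.2.1 ⟨i + 1, him⟩ := by
      simp only [System.yDot, dif_pos him]
      rw [harg, hy]
      ring
    have b2 : |S.g i (argL n i v, θ) * v.2.1 ⟨i + 1, him⟩|
        ≤ μ (argL n i v) * (1 + ‖θ‖) * xySize v := by
      rw [abs_mul]
      exact mul_le_mul hg1 hyX (abs_nonneg _) (mul_nonneg (hμ0 _).le (by positivity))
    rw [e]
    refine (abs_add_le _ _).trans ((add_le_add (hCf v θ d) b2).trans ?_)
    have p1 := mul_nonneg (hμ0 (argL n i v)).le (norm_nonneg d)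
    linarith
  choose C hCc hC0 hC using hcomp
  refine ⟨fun v => 1 + ‖xDotL n m‖ + ∑ i, C i v, by fun_prop, fun v => by
    have : 0 ≤ ∑ i, C i v := Finset.sum_nonneg fun i _ => hC0 i v
    positivity, fun w u θ hθ d ζ hζ => ?_⟩
  set v := proj n (j + 1) w with hv
  have hX := xySize_nonneg v
  have hsum : 0 ≤ ∑ i, C i v := Finset.sum_nonneg fun i _ => hC0 i v
  have hd := norm_nonneg d
  have hθn := norm_nonneg θ
  set P := xySize v * (1 + ‖θ‖) + ‖d‖ with hP
  have hP0 : 0 ≤ P := by positivity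
  have hx : ‖System.xDot w.1 w.2.1‖ ≤ ‖xDotL n m‖ * P := by
    have h1 : System.xDot w.1 w.2.1 = xDotL n m (v.1, v.2.1) := by
      have h2 : v.2.1 0 = w.2.1 0 := by
        rw [hv, proj_apply]
        simp only [low_apply]
        rw [if_pos (by simp)]
      rw [xDotL_apply]
      simp only [System.xDot, h2]
      rfl
    rw [h1]
    refine ((xDotL n m).le_opNorm _).trans (mul_le_mul_of_nonneg_left ?_ (norm_nonneg _))
    have h3 : ‖(v.1, v.2.1)‖ ≤ xySize v := by
      unfold xySize
      exact max_le (by simp) (by simp)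
    have h4 := mul_nonneg hX hθn
    linarith
  have hy : ‖low j (S.yDot w.1 w.2.1 u θ d)‖ ≤ (∑ i, C i v) * P := by
    refine (norm_vec_le_sum _).trans ?_
    rw [Finset.sum_mul]
    refine Finset.sum_le_sum fun i _ => ?_
    rw [low_apply]
    split_ifs with hij
    · exact hC i w u θ hθ d hij
    · rw [abs_zero]; exact mul_nonneg (hC0 i v) hP0
  have q1 := mul_nonneg (norm_nonneg (xDotL n m)) hP0
  have q2 := mul_nonneg hsum hP0
  have q3 := mul_nonneg (add_nonneg (norm_nonneg (xDotL n m)) hsum) hζ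
  have q4 : (1 + ‖xDotL n m‖ + ∑ i, C i v) * (P + ζ) = P + ‖xDotL n m‖ * P + (∑ i, C i v) * P + ζ
      + (‖xDotL n m‖ + ∑ i, C i v) * ζ := by ring
  rw [proj_apply]
  simp only [field]
  rw [q4]
  refine max_le (by linarith) (max_le (by linarith) ?_)
  rw [Real.norm_of_nonneg hζ]
  linarith

theorem fderiv_proj {f : State n m → ℝ} (hf : ContDiff ℝ ∞ f) {j : ℕ}
    (h : ∀ w, f (proj n j w) = f w) (w ξ : State n m) :
    fderiv ℝ f w ξ = fderiv ℝ f (proj n j w) (proj n j ξ) := by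
  have h1 : HasFDerivAt (fun w => f (proj n j w)) ((fderiv ℝ f (proj n j w)).comp (proj n j)) w :=
    ((hf.differentiable (by simp)).differentiableAt.hasFDerivAt).comp w (proj n j).hasFDerivAt
  have h2 : (fun w => f (proj n j w)) = f := funext h
  rw [h2] at h1
  rw [h1.fderiv]
  rfl

theorem norm_low_succ_le {j : ℕ} (hj : j < m) (y : Vec m) :
    ‖low (j + 1) y‖ ≤ ‖low j y‖ + |y ⟨j, hj⟩| := by
  have h1 : low (j + 1) y = low j y + PiLp.single 2 ⟨j, hj⟩ (y ⟨j, hj⟩) := by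
    ext i
    rw [PiLp.add_apply, low_apply, low_apply, PiLp.single_apply]
    by_cases h2 : i = ⟨j, hj⟩
    · subst h2; simp
    · have h3 : (i : ℕ) ≠ j := fun h => h2 (Fin.ext h)
      rw [if_neg h2, add_zero]
      split_ifs <;> first | rfl | omega
  rw [h1]
  refine (norm_add_le _ _).trans ?_
  rw [PiLp.norm_single, Real.norm_eq_abs]

/-- The coordinate `y_{i+1}` of the state. -/
noncomputable def coordL (n : ℕ) {m : ℕ} (i : Fin m) : State n m →L[ℝ] ℝ :=
  (EuclideanSpace.proj i).comp
    ((ContinuousLinearMap.fst ℝ _ _).comp (ContinuousLinearMap.snd ℝ _ _))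

theorem fderiv_add_half_sq {E : Type*} [NormedAddCommGroup E] [NormedSpace ℝ E] {V e : E → ℝ}
    {w : E} (hV : DifferentiableAt ℝ V w) (he : DifferentiableAt ℝ e w) (ξ : E) :
    fderiv ℝ (fun w => V w + e w ^ 2 / 2) w ξ = fderiv ℝ V w ξ + e w * fderiv ℝ e w ξ := by
  have h1 := hV.hasFDerivAt.add ((he.hasFDerivAt.pow 2).mul_const (2⁻¹ : ℝ))
  have h2 : HasFDerivAt (fun w => V w + e w ^ 2 / 2) _ w := h1
  rw [h2.fderiv]
  simp
  ring

set_option maxHeartbeats 1000000 in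
/-- The backstepping step: `V' = V + ½ (y_{j+1} - k)²`, and the new virtual control is
`-(y_{j+1} - k) K` with a smooth `K` so large that the damping `η K (y_{j+1} - k)²` dominates all
the terms produced by the completion of squares. -/
theorem IsStage.exists_succ [NeZero m] {S : System n m p l} {Θ : Set (Vec p)}
    (hS : S.IsRegular Θ) (hg : S.HasGainBounds Θ) {b Γ : ℝ} {κ lam : ℝ → ℝ} (hΓ : 0 < Γ)
    (hκ : IsSmoothKInf κ) (hlam : IsSmoothKInf lam) {M c σ δ : ℝ} (hM : 1 ≤ M) (hδ : 0 < δ)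
    {j : ℕ} (hj : j < m) {V k : State n m → ℝ} (h : IsStage S Θ b Γ κ lam M c σ j V k) :
    ∃ V' k' : State n m → ℝ, IsStage S Θ b Γ κ lam M (c - 1) (σ + δ) (j + 1) V' k' := by
  obtain ⟨i, hi⟩ : ∃ i : Fin m, i = ⟨j, hj⟩ := ⟨_, rfl⟩
  obtain ⟨e, he⟩ : ∃ e : State n m → ℝ, e = fun w => w.2.1 i - k w := ⟨_, rfl⟩
  have hnext : ∀ w u, nextInput j w u - k w = e w := fun w u => by
    simp only [nextInput, dif_pos hj, he, hi]
  have hec : ContDiff ℝ ∞ e := by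
    rw [he]
    exact (by fun_prop : ContDiff ℝ ∞ fun w : State n m => w.2.1 i).sub h.contDiff_k
  obtain ⟨V', hV'⟩ : ∃ V' : State n m → ℝ, V' = fun w => V w + e w ^ 2 / 2 := ⟨_, rfl⟩
  have hV'c : ContDiff ℝ ∞ V' := by
    rw [hV']
    exact h.contDiff_V.add ((hec.pow 2).div_const 2)
  have hyproj : ∀ w : State n m, (proj n (j + 1) w).2.1 i = w.2.1 i := fun w => by
    rw [proj_apply]; simp only [low_apply]; rw [if_pos (by simp [hi])]
  have heproj : ∀ w, e (proj n (j + 1) w) = e w := fun w => by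
    simp only [he]
    rw [hyproj, ← h.k_proj, proj_proj (Nat.le_succ j), h.k_proj]
  have hVproj : ∀ w, V' (proj n (j + 1) w) = V' w := fun w => by
    simp only [hV']
    rw [heproj, ← h.V_proj, proj_proj (Nat.le_succ j), h.V_proj]
  have hV'0 : ∀ w, 0 ≤ V' w := fun w => by
    rw [hV']; exact add_nonneg (h.V_nonneg w) (by positivity)
  have hVV' : ∀ w, V w ≤ V' w := fun w => by
    rw [hV']; exact le_add_of_nonneg_right (by positivity)
  have heV : ∀ w, |e w| ≤ 2 * √(V' w) := fun w => by
    have h1 : √(V' w) ^ 2 = V' w := Real.sq_sqrt (hV'0 w)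
    have h2 : e w ^ 2 / 2 ≤ V' w := by rw [hV']; exact le_add_of_nonneg_left (h.V_nonneg w)
    refine abs_le_of_sq_le_sq ?_ (by positivity)
    rw [mul_pow, h1]
    nlinarith [hV'0 w]
  have he0 : ∀ z, e (0, 0, z) = 0 := fun z => by simp [he, h.k_zero]
  -- `|(x, y₁, …, y_{j+1})| ≤ C₁ √V'`, since `k` vanishes where `(x, y₁, …, y_j)` does
  obtain ⟨C₀, hC₀c, hC₀0, hC₀⟩ := h.posDef
  obtain ⟨Ck, hCkc, hCk0, hCk⟩ := exists_le_mul_xySize h.contDiff_k h.k_zero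
  obtain ⟨C₁, hC₁e⟩ : ∃ C₁ : State n m → ℝ,
    C₁ = fun v => C₀ (proj n j v) + Ck (proj n j v) * C₀ (proj n j v) + 2 := ⟨_, rfl⟩
  have hC₁c : Continuous C₁ := by rw [hC₁e]; fun_prop
  have hC₁0 : ∀ v, 0 ≤ C₁ v := fun v => by
    have := hC₀0 (proj n j v)
    have := hCk0 (proj n j v)
    rw [hC₁e]
    positivity
  have hC₁ : ∀ w, xySize (proj n (j + 1) w) ≤ C₁ (proj n (j + 1) w) * √(V' w) := by
    intro w
    have h1 := hC₀ w
    have h2 : √(V w) ≤ √(V' w) := Real.sqrt_le_sqrt (hVV' w)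
    have h3 : |k w| ≤ Ck (proj n j w) * xySize (proj n j w) := by
      have := hCk (proj n j w)
      rwa [h.k_proj] at this
    have h4 : |w.2.1 i| ≤ |e w| + |k w| := by
      have := abs_add_le (e w) (k w)
      simpa [he] using this
    have h5 : xySize (proj n (j + 1) w) ≤ xySize (proj n j w) + |w.2.1 i| := by
      have := norm_low_succ_le hj w.2.1
      rw [← hi] at this
      simp only [xySize, proj_apply]
      linarith
    have h6 : C₀ (proj n j w) * √(V w) ≤ C₀ (proj n j w) * √(V' w) :=
      mul_le_mul_of_nonneg_left h2 (hC₀0 _)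
    have h7 := mul_le_mul_of_nonneg_left (h1.trans h6) (hCk0 (proj n j w))
    have h8 := heV w
    simp only [hC₁e]
    rw [proj_proj (Nat.le_succ j)]
    nlinarith
  -- `C₄` bounds all coefficients of the cross terms: along the field, the derivative of
  -- `y_{j+1} - k` without its input term is at most `C (√V' (1 + ‖θ‖) + ‖d‖ + ζ)`
  obtain ⟨CF, hCFc, hCF0, hCF⟩ := exists_norm_proj_field_le hS hg hj
  obtain ⟨Cf, hCfc, hCf0, hCf⟩ := exists_drift_le hS i
  obtain ⟨Q, G, hQc, hQ0, hdis, hG⟩ := h.dissip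
  obtain ⟨ρ, hρc, hρ0, hρ⟩ := hG hj
  obtain ⟨η, hηc, hη0, hη⟩ := hg.1 i
  have hDk : Continuous (fderiv ℝ k) := h.contDiff_k.continuous_fderiv (by simp)
  obtain ⟨C₄, hC₄e⟩ : ∃ C₄ : State n m → ℝ, C₄ = fun v =>
    (‖fderiv ℝ k (proj n j v)‖ * CF v + Cf v) * (C₁ v + 1) + ρ (proj n j v) := ⟨_, rfl⟩
  have hC₄c : Continuous C₄ := by rw [hC₄e]; fun_prop
  have hC₄0 : ∀ v, 0 ≤ C₄ v := fun v => by
    have := hCF0 v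
    have := hCf0 v
    have := hC₁0 v
    have := hρ0 (proj n j v)
    rw [hC₄e]
    positivity
  -- `Y` is the coefficient of `e²` left by Young's inequality, with the share `δ / (1 + κ)` given
  -- to the disturbance; `c / 2` and `Q / 2` take care of `½ e²` in `-c V'` and in the old `E Q`
  obtain ⟨Y, hYe⟩ : ∃ Y : State n m → ℝ, Y = fun v =>
    C₄ v ^ 2 * (1 + b + lam (Real.exp v.2.2) + Γ * Real.exp (-v.2.2) * √(V' v)) ^ 2 / 4
      + C₄ v ^ 2 * V' v * ((1 + κ (Real.exp v.2.2)) / (4 * δ))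
      + C₄ v ^ 2 * ((1 + κ (Real.exp v.2.2)) / (4 * δ)) := ⟨_, rfl⟩
  have hzc : Continuous fun v : State n m => v.2.2 := by fun_prop
  have hYc : Continuous Y := by
    have h1 : Continuous fun v : State n m => lam (Real.exp v.2.2) := hlam.continuous_exp.comp hzc
    have h2 : Continuous fun v : State n m => κ (Real.exp v.2.2) := hκ.continuous_exp.comp hzc
    have h3 := hV'c.continuous
    have h4 : Continuous fun v : State n m => Γ * Real.exp (-v.2.2) * √(V' v) := by fun_prop
    have h5 : Continuous fun v : State n m => (1 + κ (Real.exp v.2.2)) / (4 * δ) :=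
      (continuous_const.add h2).div_const _
    rw [hYe]
    exact ((((hC₄c.pow 2).mul (((continuous_const.add h1).add h4).pow 2)).div_const 4).add
      (((hC₄c.pow 2).mul h3).mul h5)).add ((hC₄c.pow 2).mul h5)
  obtain ⟨Ks, hKse⟩ : ∃ Ks : State n m → ℝ, Ks = fun v => c / 2 + Y v + Q (proj n j v) / 2 :=
    ⟨_, rfl⟩
  have hKsc : Continuous Ks := by rw [hKse]; fun_prop
  have hηpos : ∀ v, 0 < η (argL n i v) := fun v => hη0 _
  obtain ⟨K, hKc, hK⟩ := exists_contDiff_ge (E := State n m)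
    (f := fun v => max (Ks v / η (argL n i v)) 0) (by
      refine Continuous.max (Continuous.div hKsc ?_ fun v => (hηpos v).ne')
        continuous_const
      exact hηc.continuous.comp (argL n i).continuous)
  obtain ⟨k', hk'⟩ : ∃ k' : State n m → ℝ, k' = fun w => -(e w * K (proj n (j + 1) w)) := ⟨_, rfl⟩
  have hk'c : ContDiff ℝ ∞ k' := by
    rw [hk']; exact (hec.mul (hKc.comp (proj n (j + 1)).contDiff)).neg
  refine ⟨V', k', ?_⟩
  refine ⟨hV'c, hk'c, hVproj, fun w => ?_,
    fun z => ?_, fun z => ?_, hV'0, ⟨C₁, hC₁c, hC₁0, hC₁⟩, fun R => ?_, fun w u => ?_,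
    fun v => Q (proj n j v) + |e v| * C₄ v * (Γ * Real.exp (-v.2.2)),
    fun w θ => S.g i (argL n i w, θ) * |e w|, ?_, fun v => ?_, ?_, fun hj' => ?_⟩
  · simp only [hk']
    rw [heproj, proj_proj le_rfl]
  · simp [hV', he0, h.V_zero]
  · simp [hk', he0]
  · obtain ⟨C, hC⟩ := h.proper R
    obtain ⟨B, hB⟩ := (isCompact_closedBall (0 : State n m) C).exists_bound_of_continuousOn
      h.contDiff_k.continuous.continuousOn
    refine ⟨C + (2 * √R + B), fun w h1 h2 => ?_⟩
    have h3 := hC w h1 ((hVV' w).trans h2)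
    have h4 : |k w| ≤ B := by
      have := hB (proj n j w) (by simpa using h3)
      rwa [h.k_proj] at this
    have h5 : |e w| ≤ 2 * √R :=
      (heV w).trans (mul_le_mul_of_nonneg_left (Real.sqrt_le_sqrt h2) (by norm_num))
    have h6 : |w.2.1 i| ≤ |e w| + |k w| := by
      have := abs_add_le (e w) (k w)
      simpa [he] using this
    have h7 := norm_low_succ_le hj w.2.1
    rw [← hi] at h7
    rw [proj_apply] at h3 ⊢
    have h8 := (norm_fst_le _).trans h3
    have h9 := (norm_snd_le _).trans h3
    have h10 := (norm_fst_le _).trans h9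
    have h11 := (norm_snd_le _).trans h9
    have h12 := abs_nonneg (w.2.1 i)
    simp only at h8 h10 h11
    refine max_le ?_ (max_le ?_ ?_)
    · simp only; linarith
    · simp only; linarith
    · simp only; linarith
  · have h1 := h.coercive w u
    rw [hnext] at h1
    refine h1.trans (mul_le_mul_of_nonneg_left ?_ (zero_le_one.trans hM))
    simp only [hV']
    exact le_add_of_nonneg_right (by positivity)
  · have := hec.continuous
    fun_prop
  · have := hQ0 (proj n j v)
    have := hC₄0 v
    positivity
  · intro w u θ hθ d ζ E hE hζ hζE
    set v := proj n (j + 1) w with hv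
    have hz : v.2.2 = w.2.2 := rfl
    have hjv : proj n j v = proj n j w := proj_proj (Nat.le_succ j) w
    set A := √(V' w) with hA
    have hA0 : 0 ≤ A := Real.sqrt_nonneg _
    have hA2 : A ^ 2 = V' w := Real.sq_sqrt (hV'0 w)
    set γ := Γ * Real.exp (-w.2.2) with hγ
    have hγ0 : 0 ≤ γ := by positivity
    set ξ := field S w u θ d ζ with hξ
    have hd := norm_nonneg d
    have hθn := norm_nonneg θ
    have hX := xySize_nonneg v
    have harg : argL n i v = (w.1, trunc i w.2.1) := by
      rw [hv, argL_proj i (by simp [hi]), argL_apply]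
    have hder : fderiv ℝ V' w ξ = fderiv ℝ V w ξ + e w * (ξ.2.1 i - fderiv ℝ k w ξ) := by
      have d2 : DifferentiableAt ℝ k w := (h.contDiff_k.differentiable (by simp)) w
      have d3 : fderiv ℝ e w ξ = ξ.2.1 i - fderiv ℝ k w ξ := by
        have d4 : HasFDerivAt e (coordL n i - fderiv ℝ k w) w := by
          rw [he]
          exact (coordL n i).hasFDerivAt.sub d2.hasFDerivAt
        rw [d4.fderiv]
        rfl
      rw [← d3, hV']
      exact fderiv_add_half_sq ((h.contDiff_V.differentiable (by simp)) w)
        ((hec.differentiable (by simp)) w) ξ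
    set P := A * (1 + ‖θ‖) + ‖d‖ + ζ with hP
    have hP0 : 0 ≤ P := by positivity
    have hXP : xySize v * (1 + ‖θ‖) + ‖d‖ + ζ ≤ (C₁ v + 1) * P := by
      have h1 := mul_le_mul_of_nonneg_right (hC₁ w) (by positivity : (0 : ℝ) ≤ 1 + ‖θ‖)
      have h2 := mul_nonneg (hC₁0 v) (add_nonneg hd hζ)
      have h3 : 0 ≤ A * (1 + ‖θ‖) := by positivity
      rw [hP]
      linarith
    have hdk : |fderiv ℝ k w ξ| ≤ ‖fderiv ℝ k (proj n j v)‖ * CF v * ((C₁ v + 1) * P) := by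
      rw [fderiv_proj h.contDiff_k h.k_proj, hjv]
      refine ((fderiv ℝ k (proj n j w)).le_opNorm _).trans ?_
      rw [mul_assoc]
      exact mul_le_mul_of_nonneg_left ((hCF w u θ hθ d ζ hζ).trans
        (mul_le_mul_of_nonneg_left hXP (hCF0 v))) (norm_nonneg _)
    set r := S.h i (argL n i v) + inner ℝ (S.φ i (argL n i v)) θ
      + inner ℝ (S.α i (argL n i v)) d with hr
    have hrle : |r| ≤ Cf v * ((C₁ v + 1) * P) :=
      (hCf v θ d).trans (mul_le_mul_of_nonneg_left (by linarith) (hCf0 v))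
    have hy : ξ.2.1 i = r + S.g i (argL n i v, θ) * nextInput (j + 1) w u := by
      simp only [hξ, field, System.yDot, hr, harg, nextInput, hi]
      ring
    have hcross : e w * (r - fderiv ℝ k w ξ)
        ≤ |e w| * ((‖fderiv ℝ k (proj n j v)‖ * CF v + Cf v) * (C₁ v + 1) * P) := by
      refine (le_abs_self _).trans ?_
      rw [abs_mul]
      refine mul_le_mul_of_nonneg_left ((abs_sub _ _).trans ?_) (abs_nonneg _)
      linarith
    -- the previous stage sees `½ e²` as part of what later stages add, hence the shift of `E`
    have hold := hdis w u θ hθ d ζ (e w ^ 2 / 2 + E) (by positivity) hζ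
      (hζE.trans (le_of_eq (by simp only [hV']; ring)))
    rw [hnext, ← hξ] at hold
    have hGle : G w θ * |e w| ≤ |e w| * (ρ (proj n j v) * P) := by
      rw [mul_comm, hjv]
      refine mul_le_mul_of_nonneg_left ((hρ w θ hθ).trans ?_) (abs_nonneg _)
      rw [mul_assoc]
      refine mul_le_mul_of_nonneg_left ?_ (hρ0 _)
      have h1 := mul_le_mul_of_nonneg_right (Real.sqrt_le_sqrt (hVV' w))
        (by positivity : (0 : ℝ) ≤ 1 + ‖θ‖)
      linarith
    have hPle : |e w| * (C₄ v * P) ≤ |e w| * (C₄ v * (A * (1 + ‖θ‖) + ‖d‖ + γ * A ^ 2))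
        + E * (|e w| * C₄ v * γ) := by
      have h1 : P ≤ A * (1 + ‖θ‖) + ‖d‖ + γ * A ^ 2 + γ * E := by
        rw [hP, hA2]; linarith
      have h2 := mul_le_mul_of_nonneg_left h1 (mul_nonneg (abs_nonneg (e w)) (hC₄0 v))
      linarith
    set q := max (‖θ‖ - b - lam (Real.exp w.2.2)) 0 with hq
    have hκ1 : 0 < 1 + κ (Real.exp w.2.2) := by linarith [hκ.nonneg_exp w.2.2]
    have hyoung := young_backstepping (e := |e w|) (C := C₄ v) (A := A) (T := 1 + ‖θ‖) (D := ‖d‖)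
      (Λ := 1 + b + lam (Real.exp w.2.2)) (q := q) (γ := γ) (τ := δ / (1 + κ (Real.exp w.2.2)))
      (V := V' w) (abs_nonneg _) (hC₄0 v) hA0
      (by have := le_max_left (‖θ‖ - b - lam (Real.exp w.2.2)) 0; linarith) (by positivity) hA2
    have hYv : C₄ v ^ 2 * (1 + b + lam (Real.exp w.2.2) + γ * A) ^ 2 / 4
        + C₄ v ^ 2 * V' w / (4 * (δ / (1 + κ (Real.exp w.2.2))))
        + C₄ v ^ 2 / (4 * (δ / (1 + κ (Real.exp w.2.2)))) = Y v := by
      simp only [hYe]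
      rw [hVproj, hz, ← hA, ← hγ]
      field_simp
    rw [hYv, sq_abs] at hyoung
    -- `g K ≥ η K ≥ Ks` turns the input term into `-Ks e²`, up to the error of the next stage
    have hKv := hK v
    have hK0 : 0 ≤ K v := (le_max_right _ _).trans hKv
    have hKs : Ks v ≤ η (argL n i v) * K v := by
      have h1 := (le_max_left _ _).trans hKv
      rwa [div_le_iff₀ (hηpos v), mul_comm] at h1
    have hgη := hη (argL n i v) θ hθ
    have hdamp : e w * (S.g i (argL n i v, θ) * nextInput (j + 1) w u) ≤ -(Ks v * e w ^ 2)
        + S.g i (argL n i v, θ) * |e w| * |nextInput (j + 1) w u - k' w| := by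
      have hg0 : 0 ≤ S.g i (argL n i v, θ) := (hηpos v).le.trans hgη
      have h1 : e w * (nextInput (j + 1) w u - k' w)
          ≤ |e w| * |nextInput (j + 1) w u - k' w| := by
        rw [← abs_mul]; exact le_abs_self _
      have h2 := mul_le_mul_of_nonneg_left h1 hg0
      have h3 := mul_le_mul_of_nonneg_right
        (hKs.trans (mul_le_mul_of_nonneg_right hgη hK0)) (sq_nonneg (e w))
      have h4 : e w * (S.g i (argL n i v, θ) * nextInput (j + 1) w u)
          = S.g i (argL n i v, θ) * (e w * (nextInput (j + 1) w u - k' w))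
            - S.g i (argL n i v, θ) * K v * e w ^ 2 := by
        simp only [hk', ← hv]; ring
      rw [h4]
      linarith
    have hσ : (σ + δ) / (1 + κ (Real.exp w.2.2)) * (‖d‖ ^ 2 + q ^ 2)
        = σ / (1 + κ (Real.exp w.2.2)) * (‖d‖ ^ 2 + q ^ 2)
          + δ / (1 + κ (Real.exp w.2.2)) * (‖d‖ ^ 2 + q ^ 2) := by ring
    have hargw : argL n i w = argL n i v := by rw [harg, argL_apply]
    beta_reduce
    rw [hder, hy, hσ, hargw, heproj, hz, hjv]
    simp only [hKse, hjv] at hdamp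
    have hC₄v : |e w| * (C₄ v * P)
        = |e w| * ((‖fderiv ℝ k (proj n j v)‖ * CF v + Cf v) * (C₁ v + 1) * P)
          + |e w| * (ρ (proj n j v) * P) := by simp only [hC₄e]; ring
    have hV'w : c * V' w = c * V w + c * (e w ^ 2 / 2) := by simp only [hV']; ring
    have hsplit : e w * (r + S.g i (argL n i v, θ) * nextInput (j + 1) w u - fderiv ℝ k w ξ)
        = e w * (r - fderiv ℝ k w ξ) + e w * (S.g i (argL n i v, θ) * nextInput (j + 1) w u) := by
      ring
    rw [hsplit, ← hγ]
    clear_value A γ P q r ξ v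
    linarith
  · obtain ⟨μ, hμc, hμ0, hμ⟩ := hg.2 i (by rw [hi]; exact hj')
    refine ⟨fun v => 2 * μ (argL n i v), ?_, fun v => by have := hμ0 (argL n i v); positivity,
      fun w θ hθ => ?_⟩
    · have := hμc.continuous
      fun_prop
    · have h1 := hμ (argL n i w) θ hθ
      have h2 := mul_le_mul h1 (heV w) (abs_nonneg _)
        (mul_nonneg (hμ0 _).le (by positivity))
      beta_reduce
      rw [argL_proj i (j := j + 1) (by simp [hi])]
      linarith

/-- The backstepping design exists for every decay rate and every disturbance gain. -/
theorem exists_isLyapunovPair [NeZero n] [NeZero m] {S : System n m p l} {Θ : Set (Vec p)}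
    (hS : S.IsRegular Θ) (hg : S.HasGainBounds Θ) {b Γ ε c a : ℝ} (hΓ : 0 < Γ) (ha : 0 < a)
    {κ lam : ℝ → ℝ} (hκ : IsSmoothKInf κ) (hlam : IsSmoothKInf lam) :
    ∃ (k V : State n m → ℝ) (M : ℝ), IsLyapunovPair S Θ b Γ ε c a κ lam k V M := by
  obtain ⟨M, hM, hbase⟩ := exists_isStage_zero S Θ b Γ κ lam (c + m)
  have hm : (0 : ℝ) < m := Nat.cast_pos.2 (NeZero.pos m)
  have hM0 : 0 < M := zero_lt_one.trans_le hM
  have key : ∀ j : ℕ, j ≤ m → ∃ V k : State n m → ℝ,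
      IsStage S Θ b Γ κ lam M (c + m - j) (j * (a / M / m)) j V k := by
    intro j
    induction j with
    | zero => intro _; simpa using hbase
    | succ j ih =>
      intro hj
      obtain ⟨V, k, h⟩ := ih (by omega)
      obtain ⟨V', k', h'⟩ := h.exists_succ hS hg hΓ hκ hlam hM
        (δ := a / M / m) (by positivity) (by omega)
      refine ⟨V', k', ?_⟩
      convert h' using 1
      · push_cast; ring
      · push_cast; ring
  obtain ⟨V, k, h⟩ := key m le_rfl
  refine ⟨k, V, M, IsStage.isLyapunovPair hΓ hM ?_⟩
  convert h using 1
  · ring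
  · field_simp

end DADS

theorem theorem1 {n m p l : ℕ} [NeZero n] [NeZero m]
    (Θ : Set (DADS.Vec p)) (hΘ : Θ.Nonempty)
    (S : DADS.System n m p l) (hS : S.IsRegular Θ) (hg : S.HasGainBounds Θ)
    (b Γ ε c a : ℝ) (hb : 0 < b) (hΓ : 0 < Γ) (hε : 0 < ε) (hc : 0 < c) (ha : 0 < a)
    (κ lam : ℝ → ℝ) (hκ : DADS.IsSmoothKInf κ) (hlam : DADS.IsSmoothKInf lam) :
    ∃ (k V : DADS.State n m → ℝ) (M : ℝ)
      (B : DADS.Vec n × DADS.Vec m × ℝ × ℝ≥0 × ℝ≥0 → ℝ),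
      ContDiff ℝ ∞ k ∧ ContDiff ℝ ∞ V ∧
      (∀ z : ℝ, V (0, 0, z) = 0 ∧ k (0, 0, z) = 0) ∧
      (∀ (x : DADS.Vec n) (y : DADS.Vec m) (z : ℝ), (x, y) ≠ 0 → 0 < V (x, y, z)) ∧
      1 ≤ M ∧ Continuous B ∧
      ∀ (x₀ : DADS.Vec n) (y₀ : DADS.Vec m) (z₀ : ℝ)
        (d : ℝ → DADS.Vec l) (θ : ℝ → DADS.Vec p),
        DADS.IsLInf univ d → DADS.IsLInf Θ θ →
        ∃ (x : ℝ → DADS.Vec n) (y : ℝ → DADS.Vec m) (z : ℝ → ℝ) (zInf : ℝ),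
          DADS.IsUniqueGlobalSolution (fun t => S.closedLoop k V Γ ε M (θ t) (d t))
            (x₀, y₀, z₀) (fun t => (x t, y t, z t)) ∧
          limsup (fun t => ‖x t‖ + |y t 0|) atTop ≤ ε ∧
          limsup (fun t => V (x t, y t, z t)) atTop ≤ ε ^ 2 / (2 * M) ∧
          Tendsto z atTop (𝓝 zInf) ∧
          (∀ t : ℝ, 0 ≤ t → z₀ ≤ z t ∧ z t ≤ zInf) ∧
          zInf ≤ B (x₀, y₀, z₀, DADS.supNorm d, DADS.supNorm θ) ∧
          (∀ t : ℝ, 0 ≤ t →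
            ‖x t‖ + ‖y t‖ ≤ B (x₀, y₀, z₀, DADS.supNorm d, DADS.supNorm θ)) ∧
          (∀ t : ℝ, 0 ≤ t →
            ‖x t‖ ^ 2 + |y t 0| ^ 2 ≤ M * V (x t, y t, z t) ∧
            M * V (x t, y t, z t) ≤ M * Real.exp (-c * t) * V (x₀, y₀, z₀)
              + a * (((DADS.supNorm d : ℝ) ^ 2
                  + max ((DADS.supNorm θ : ℝ) - b - lam (Real.exp z₀)) 0 ^ 2)
                / (c * (1 + κ (Real.exp z₀))))) ∧
          (Tendsto d DADS.essAtTop (𝓝 0) →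
            limsup (fun t => ‖θ t‖) DADS.essAtTop ≤ b + lam (Real.exp zInf) →
            Tendsto (fun t => ‖x t‖ + ‖y t‖) atTop (𝓝 0)) := by
  obtain ⟨k, V, M, hP⟩ :=
    DADS.exists_isLyapunovPair (b := b) (Γ := Γ) (ε := ε) (c := c) (a := a) hS hg hΓ ha hκ hlam
  obtain ⟨B, hB, h⟩ := hP.closedLoop_properties hΘ hS hΓ hε hc ha hκ hlam
  exact ⟨k, V, M, B, hP.contDiff_k, hP.contDiff_V, fun z => ⟨hP.V_zero z, hP.k_zero z⟩, hP.V_pos,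
    hP.one_le, hB, h⟩
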